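/- Let $\kappa>0$ and let $A(\kappa)=\{\vec k\in\mathbf R^2: |\vec k|=\kappa\}$. Let $E_{\kappa^2}(\mathbf R^2)$ be the real Banach space of real-valued fields $\Lambda(\vec r)=\sum_{\vec k\in A(\kappa)}a(\vec k)\,e^{i\vec k\cdot\vec r}$ with $a(-\vec k)=\overline{a(\vec k)}$ and finite norm $\|\Lambda\|=\sum_{\vec k}|a(\vec k)|$ (the closure in this norm of the finite sums of this form). The Euclidean group $E(2)$ of all isometries of $\mathbf R^2$ acts linearly on it by $(\gamma\cdot\Lambda)(\vec r)=\Lambda(\gamma^{-1}\vec r)$. Let $B_P\subset E(2)$ be the group generated by the translations by $(2\pi,0)$ and $(0,2\pi)$, and let $E_{\kappa^2}(\tilde\Omega)=\mathrm{Fix}\,B_P\subset E_{\kappa^2}(\mathbf R^2)$ be the subspace of fields that are $2\pi$-periodic in both coordinates. Let $\tilde D_4\ltimes T^2$ be the group generated by the reflections $(x,y)\mapsto(-x,y)$, $(x,y)\mapsto(y,x)$ and all translations of the plane, modulo $B_P$; it acts on $E_{\kappa^2}(\tilde\Omega)$. **Theorem.** Suppose that the real representation of $\tilde D_4\ltimes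 T^2$ on $E_{\kappa^2}(\tilde\Omega)$ is irreducible. Then for every (not necessarily linear) $\tilde D_4\ltimes T^2$-equivariant map $\tilde F:E_{\kappa^2}(\tilde\Omega)\to E_{\kappa^2}(\tilde\Omega)$ there is an $E(2)$-equivariant map $\mathcal F:E_{\kappa^2}(\mathbf R^2)\to E_{\kappa^2}(\mathbf R^2)$ such that $\tilde F=\mathcal F|_{E_{\kappa^2}(\tilde\Omega)}$. Moreover $\mathcal F$ can be chosen to be $C^\infty$ (in the sense of Fréchet) if $\tilde F$ is $C^\infty$, and to be a continuous homogeneous polynomial map of degree $p$ if $\tilde F$ is a homogeneous polynomial map of degree $p$. -/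

import Mathlib

open scoped ComplexConjugate ContDiff

noncomputable section

namespace HiddenSymmetry

/-! ### The Euclidean group of the plane -/

/-- The plane `ℝ²` with its Euclidean norm. -/
abbrev Plane : Type := EuclideanSpace ℝ (Fin 2)

/-- The Euclidean group `E(2)`: all isometries of the plane, with composition. -/
abbrev E2 : Type := Plane ≃ᵃⁱ[ℝ] Plane

/-- The translation `r ↦ v + r`. -/
def translation (v : Plane) : E2 := AffineIsometryEquiv.constVAdd ℝ Plane v

/-- The reflection `(x, y) ↦ (-x, y)`. -/
def reflX : E2 :=
  (LinearIsometryEquiv.piLpCongrRight 2 (fun i : Fin 2 =>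
    if i = 0 then LinearIsometryEquiv.neg ℝ (E := ℝ)
    else LinearIsometryEquiv.refl ℝ ℝ)).toAffineIsometryEquiv

/-- The diagonal reflection `(x, y) ↦ (y, x)`. -/
def reflDiag : E2 :=
  (LinearIsometryEquiv.piLpCongrLeft 2 ℝ ℝ (Equiv.swap (0 : Fin 2) 1)).toAffineIsometryEquiv

lemma translation_apply (v r : Plane) : translation v r = v + r := rfl

lemma reflX_apply (r : Plane) : reflX r = !₂[-r 0, r 1] := by
  ext i; fin_cases i <;> simp [reflX]

lemma reflDiag_apply (r : Plane) : reflDiag r = !₂[r 1, r 0] := by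
  ext i; fin_cases i <;> simp [reflDiag, LinearIsometryEquiv.piLpCongrLeft_apply]

/-- The group `B_P` of periodicity conditions, generated by the translations by `2π` along the two
coordinate axes. -/
def BP : Subgroup E2 :=
  Subgroup.closure {translation !₂[2 * Real.pi, 0], translation !₂[0, 2 * Real.pi]}

/-- The subgroup of `E(2)` generated by all translations and by the two reflections
`(x, y) ↦ (-x, y)` and `(x, y) ↦ (y, x)` (which generate the symmetry group of the square). -/
def squareEuclidean : Subgroup E2 :=
  Subgroup.closure ({reflX, reflDiag} ∪ Set.range translation)

lemma translation_conj (g : E2) (v : Plane) :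
    g * translation v * g⁻¹ = translation (g.linearIsometryEquiv v) := by
  ext1 r
  have h : g (g⁻¹ r) = r := g.apply_symm_apply r
  change g (v +ᵥ g⁻¹ r) = g.linearIsometryEquiv v +ᵥ r
  rw [AffineIsometryEquiv.map_vadd, h]

lemma translation_inv (v : Plane) : (translation v)⁻¹ = translation (-v) := by
  rw [inv_eq_iff_mul_eq_one]
  ext1 r
  change v + (-v + r) = r
  simp

lemma reflX_mul_self : reflX * reflX = 1 := by
  ext1 r
  change reflX (reflX r) = r
  rw [reflX_apply, reflX_apply]
  ext i; fin_cases i <;> simp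

lemma reflDiag_mul_self : reflDiag * reflDiag = 1 := by
  ext1 r
  change reflDiag (reflDiag r) = r
  rw [reflDiag_apply, reflDiag_apply]
  ext i; fin_cases i <;> simp

lemma BP_le : BP ≤ squareEuclidean := by
  rw [BP, Subgroup.closure_le]
  rintro g (rfl | rfl)
  · exact Subgroup.subset_closure (Or.inr ⟨_, rfl⟩)
  · exact Subgroup.subset_closure (Or.inr ⟨_, rfl⟩)

/-- An element conjugates `B_P` into itself if it does so for the two generators. -/
lemma conj_mem_BP {g : E2}
    (h₁ : g * translation !₂[2 * Real.pi, 0] * g⁻¹ ∈ BP)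
    (h₂ : g * translation !₂[0, 2 * Real.pi] * g⁻¹ ∈ BP) {b : E2} (hb : b ∈ BP) :
    g * b * g⁻¹ ∈ BP := by
  have : BP ≤ BP.comap (MulAut.conj g).toMonoidHom := by
    conv_lhs => rw [BP]
    rw [Subgroup.closure_le]
    rintro x (rfl | rfl)
    · exact h₁
    · exact h₂
  exact this hb

lemma conj_reflX_mem_BP {b : E2} (hb : b ∈ BP) : reflX * b * reflX⁻¹ ∈ BP := by
  refine conj_mem_BP ?_ ?_ hb
  · have : reflX * translation !₂[2 * Real.pi, 0] * reflX⁻¹ =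
        (translation !₂[2 * Real.pi, 0])⁻¹ := by
      rw [translation_conj, translation_inv]
      congr 1
      change reflX !₂[2 * Real.pi, 0] = _
      rw [reflX_apply]
      ext i; fin_cases i <;> simp
    rw [this]
    exact inv_mem (Subgroup.subset_closure (Or.inl rfl))
  · have : reflX * translation !₂[0, 2 * Real.pi] * reflX⁻¹ =
        translation !₂[0, 2 * Real.pi] := by
      rw [translation_conj]
      congr 1
      change reflX !₂[0, 2 * Real.pi] = _
      rw [reflX_apply]
      ext i; fin_cases i <;> simp
    rw [this]
    exact Subgroup.subset_closure (Or.inr rfl)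

lemma conj_reflDiag_mem_BP {b : E2} (hb : b ∈ BP) : reflDiag * b * reflDiag⁻¹ ∈ BP := by
  refine conj_mem_BP ?_ ?_ hb
  · have : reflDiag * translation !₂[2 * Real.pi, 0] * reflDiag⁻¹ =
        translation !₂[0, 2 * Real.pi] := by
      rw [translation_conj]
      congr 1
      change reflDiag !₂[2 * Real.pi, 0] = _
      rw [reflDiag_apply]
      ext i; fin_cases i <;> simp
    rw [this]
    exact Subgroup.subset_closure (Or.inr rfl)
  · have : reflDiag * translation !₂[0, 2 * Real.pi] * reflDiag⁻¹ =
        translation !₂[2 * Real.pi, 0] := by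
      rw [translation_conj]
      congr 1
      change reflDiag !₂[0, 2 * Real.pi] = _
      rw [reflDiag_apply]
      ext i; fin_cases i <;> simp
    rw [this]
    exact Subgroup.subset_closure (Or.inl rfl)

lemma conj_translation_mem_BP (v : Plane) {b : E2} (hb : b ∈ BP) :
    translation v * b * (translation v)⁻¹ ∈ BP := by
  have key : ∀ w : Plane,
      translation v * translation w * (translation v)⁻¹ = translation w := by
    intro w
    rw [translation_conj]
    congr 1
  refine conj_mem_BP ?_ ?_ hb
  · rw [key]; exact Subgroup.subset_closure (Or.inl rfl)
  · rw [key]; exact Subgroup.subset_closure (Or.inr rfl)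

lemma conj_mem_BP_of_mem {g : E2} (hg : g ∈ squareEuclidean) {b : E2} (hb : b ∈ BP) :
    g * b * g⁻¹ ∈ BP := by
  have hle : squareEuclidean ≤ Subgroup.normalizer (BP : Set E2) := by
    rw [squareEuclidean, Subgroup.closure_le]
    have inv_of : ∀ g : E2, (∀ b ∈ BP, g * b * g⁻¹ ∈ BP) → (∀ b ∈ BP, g⁻¹ * b * g⁻¹⁻¹ ∈ BP) →
        g ∈ Subgroup.normalizer (BP : Set E2) := by
      intro g h h'
      rw [Subgroup.mem_normalizer_iff]
      refine fun b => ⟨h b, fun hb => ?_⟩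
      have := h' _ hb
      simpa [mul_assoc] using this
    rintro x ((rfl | rfl) | ⟨v, rfl⟩)
    · have hinv : reflX⁻¹ = reflX := inv_eq_of_mul_eq_one_left reflX_mul_self
      refine inv_of _ (fun b hb => conj_reflX_mem_BP hb) (fun b hb => ?_)
      rw [hinv]; exact conj_reflX_mem_BP hb
    · have hinv : reflDiag⁻¹ = reflDiag := inv_eq_of_mul_eq_one_left reflDiag_mul_self
      refine inv_of _ (fun b hb => conj_reflDiag_mem_BP hb) (fun b hb => ?_)
      rw [hinv]; exact conj_reflDiag_mem_BP hb
    · refine inv_of _ (fun b hb => conj_translation_mem_BP v hb) (fun b hb => ?_)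
      rw [translation_inv]; exact conj_translation_mem_BP (-v) hb
  exact ((Subgroup.mem_normalizer_iff.mp (hle hg)) b).mp hb

instance : (BP.subgroupOf squareEuclidean).Normal where
  conj_mem := fun _ hb g => conj_mem_BP_of_mem g.2 hb

/-- The group `D̃₄ ⋉ T²`, where `D̃₄` is generated by the reflections `(x, y) ↦ (-x, y)` and
`(x, y) ↦ (y, x)`, and `T²` consists of the translations of the plane modulo `2πℤ²`. -/
abbrev D4T2 : Type := squareEuclidean ⧸ BP.subgroupOf squareEuclidean

/-! ### The eigenspace on the plane -/

/-- The circle `A(κ)` of wave vectors of length `κ`. -/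
abbrev Circ (κ : ℝ) : Type := Metric.sphere (0 : Plane) κ

/-- The `ℓ¹` space of all absolutely summable families of amplitudes `a(k)`, `k ∈ A(κ)`, with
norm `∑ |a(k)|`. -/
abbrev Amp (κ : ℝ) : Type := lp (fun _ : Circ κ => ℂ) 1

/-- The eigenspace `E_{κ²}(ℝ²)`: the amplitudes `a ∈ ℓ¹(A(κ))` of the real-valued fields
`Λ(r) = ∑ a(k) exp(i k·r)`, that is, those with `a(-k) = conj a(k)`. -/
def eigenspace (κ : ℝ) : Submodule ℝ (Amp κ) where
  carrier := {a | ∀ k, a (-k) = conj (a k)}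
  add_mem' := by
    intro a b ha hb k
    simp only [lp.coeFn_add, Pi.add_apply, map_add, ha k, hb k]
  zero_mem' := by intro k; simp
  smul_mem' := by
    intro c a ha k
    simp only [lp.coeFn_smul, Pi.smul_apply, ha k, Complex.real_smul, map_mul, Complex.conj_ofReal]

lemma mem_eigenspace {κ : ℝ} {a : Amp κ} :
    a ∈ eigenspace κ ↔ ∀ k, a (-k) = conj (a k) := Iff.rfl

/-- `E_{κ²}(ℝ²)` is the closure of the space of finite sums of plane waves in the `ℓ¹` norm. -/
theorem dense_finite_sums (κ : ℝ) :
    Dense {a : eigenspace κ | {k | (a : Amp κ) k ≠ 0}.Finite} := by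
  classical
  intro a
  rw [Metric.mem_closure_iff]
  intro ε hε
  have hs := lp.hasSum_single (p := 1) ENNReal.one_ne_top (a : Amp κ)
  obtain ⟨s, hs⟩ := Filter.eventually_atTop.mp (Metric.tendsto_nhds.mp hs ε hε)
  set t : Finset (Circ κ) := s ∪ s.image (fun k => -k) with ht
  have htn : ∀ k, -k ∈ t ↔ k ∈ t := by
    intro k
    simp only [ht, Finset.mem_union, Finset.mem_image, neg_inj, exists_eq_right]
    rw [or_comm]
    simp [neg_eq_iff_eq_neg]
  set b : Amp κ := ∑ k ∈ t, lp.single 1 k ((a : Amp κ) k) with hb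
  have hbk : ∀ k, b k = if k ∈ t then (a : Amp κ) k else 0 := by
    intro k
    rw [hb, lp.coeFn_sum, Finset.sum_apply]
    simp [lp.single_apply, Pi.single_apply]
  have hbe : b ∈ eigenspace κ := by
    rw [mem_eigenspace]
    intro k
    rw [hbk, hbk]
    by_cases hk : k ∈ t
    · rw [if_pos hk, if_pos ((htn k).mpr hk)]
      exact mem_eigenspace.mp a.2 k
    · rw [if_neg hk, if_neg (fun h => hk ((htn k).mp h)), map_zero]
  refine ⟨⟨b, hbe⟩, t.finite_toSet.subset ?_, ?_⟩
  · intro k hk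
    by_contra h
    exact hk ((hbk k).trans (if_neg h))
  · rw [dist_comm]
    exact hs t Finset.subset_union_left

/-- The field `Λ(r) = ∑ a(k) exp(i k·r)` with amplitudes `a`. -/
def field {κ : ℝ} (a : Amp κ) (r : Plane) : ℂ :=
  ∑' k : Circ κ, a k * Complex.exp (Complex.I * (inner ℝ (k : Plane) r : ℝ))

/-- The linear action of an element of `O(2)` on the circle of wave vectors. -/
def rotCirc {κ : ℝ} (L : Plane ≃ₗᵢ[ℝ] Plane) : Circ κ ≃ Circ κ where
  toFun k := ⟨L k, by simp⟩
  invFun k := ⟨L.symm k, by simp⟩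
  left_inv k := by ext1; simp
  right_inv k := by ext1; simp

/-- The amplitudes of the transformed field `r ↦ Λ(g⁻¹ r)`. If `g r = L r + b` with `L`
orthogonal, the new amplitude at `k` is `exp(-i k·b) a(L⁻¹ k)`. -/
def transformed {κ : ℝ} (g : E2) (a : Circ κ → ℂ) (k : Circ κ) : ℂ :=
  Complex.exp (-(Complex.I * (inner ℝ (k : Plane) (g 0) : ℝ))) *
    a ((rotCirc g.linearIsometryEquiv).symm k)

lemma norm_phase (t : ℝ) : ‖Complex.exp (-(Complex.I * (t : ℂ)))‖ = 1 := by
  rw [show -(Complex.I * (t : ℂ)) = ((-t : ℝ) : ℂ) * Complex.I by push_cast; ring]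
  exact Complex.norm_exp_ofReal_mul_I _

lemma memℓp_transformed {κ : ℝ} (g : E2) (a : Amp κ) :
    Memℓp (transformed g (a : Circ κ → ℂ)) 1 := by
  have h := lp.memℓp a
  rw [memℓp_gen_iff (by simp)] at h ⊢
  simp only [ENNReal.toReal_one, Real.rpow_one] at h ⊢
  refine ((rotCirc g.linearIsometryEquiv).symm.summable_iff.mpr h).congr (fun k => ?_)
  simp [transformed, norm_phase]

lemma transformed_neg {κ : ℝ} (g : E2) {a : Circ κ → ℂ} (ha : ∀ k, a (-k) = conj (a k))
    (k : Circ κ) : transformed g a (-k) = conj (transformed g a k) := by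
  have h : (rotCirc (κ := κ) g.linearIsometryEquiv).symm (-k) =
      -(rotCirc g.linearIsometryEquiv).symm k := by
    ext1; simp [rotCirc]
  rw [transformed, transformed, h, ha, map_mul, ← Complex.exp_conj]
  simp

lemma transformed_one {κ : ℝ} (a : Circ κ → ℂ) : transformed 1 a = a := by
  funext k
  have h : (rotCirc (κ := κ) (1 : E2).linearIsometryEquiv).symm k = k := rfl
  have h0 : (1 : E2) 0 = 0 := rfl
  rw [transformed, h, h0]
  simp

lemma transformed_mul {κ : ℝ} (g h : E2) (a : Circ κ → ℂ) :
    transformed (g * h) a = transformed g (transformed h a) := by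
  funext k
  have h1 : (rotCirc (κ := κ) (g * h).linearIsometryEquiv).symm k =
    (rotCirc h.linearIsometryEquiv).symm ((rotCirc g.linearIsometryEquiv).symm k) := rfl
  have h2 : (g * h) 0 = g.linearIsometryEquiv (h 0) + g 0 := by
    have := g.map_vadd 0 (h 0)
    simpa using this
  have h3 : inner ℝ (((rotCirc (κ := κ) g.linearIsometryEquiv).symm k : Circ κ) : Plane) (h 0)
      = inner ℝ (k : Plane) (g.linearIsometryEquiv (h 0)) := by
    rw [← g.linearIsometryEquiv.inner_map_map]
    simp [rotCirc]
  unfold transformed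
  rw [h1, h2, h3, ← mul_assoc, ← Complex.exp_add, inner_add_right]
  congr 2
  push_cast; ring

/-- The action of a single element of `E(2)` on the amplitudes of real-valued fields. -/
def transformedWave {κ : ℝ} (g : E2) (a : eigenspace κ) : eigenspace κ :=
  ⟨⟨transformed g ((a : Amp κ) : Circ κ → ℂ), memℓp_transformed g (a : Amp κ)⟩,
    mem_eigenspace.mpr (transformed_neg g (mem_eigenspace.mp a.2))⟩

/-- The action of a single element of `E(2)` on `E_{κ²}(ℝ²)`, as a linear map. -/
def euclidAct (κ : ℝ) (g : E2) : eigenspace κ →ₗ[ℝ] eigenspace κ where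
  toFun := transformedWave g
  map_add' a b := by
    refine Subtype.ext (lp.ext (funext fun k => ?_))
    exact mul_add _ _ _
  map_smul' c a := by
    refine Subtype.ext (lp.ext (funext fun k => ?_))
    exact mul_smul_comm c _ _

/-- The action of `E(2)` on `E_{κ²}(ℝ²)`, by `(g · Λ)(r) = Λ(g⁻¹ r)`. -/
def euclidRep (κ : ℝ) : Representation ℝ E2 (eigenspace κ) where
  toFun := euclidAct κ
  map_one' := LinearMap.ext fun _ => Subtype.ext (lp.ext (transformed_one _))
  map_mul' g h := LinearMap.ext fun _ => Subtype.ext (lp.ext (transformed_mul g h _))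

lemma euclidRep_apply {κ : ℝ} (g : E2) (a : eigenspace κ) (k : Circ κ) :
    (euclidRep κ g a : Amp κ) k =
      Complex.exp (-(Complex.I * (inner ℝ (k : Plane) (g 0) : ℝ))) *
        (a : Amp κ) ((rotCirc g.linearIsometryEquiv).symm k) := rfl

/-- The action on amplitudes is the geometric action on fields. -/
theorem field_euclidRep {κ : ℝ} (g : E2) (a : eigenspace κ) (r : Plane) :
    field (euclidRep κ g a : Amp κ) r = field (a : Amp κ) (g⁻¹ r) := by
  unfold field
  rw [← (rotCirc (κ := κ) g.linearIsometryEquiv).tsum_eq]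
  refine tsum_congr fun k => ?_
  have hr : r = g.linearIsometryEquiv (g⁻¹ r) + g 0 := by
    have h := g.map_vadd 0 (g⁻¹ r)
    have h' : g (g⁻¹ r) = r := g.apply_symm_apply r
    simpa [h'] using h
  have hin : inner ℝ (((rotCirc (κ := κ) g.linearIsometryEquiv) k : Circ κ) : Plane) r =
      inner ℝ (k : Plane) (g⁻¹ r) +
        inner ℝ (((rotCirc (κ := κ) g.linearIsometryEquiv) k : Circ κ) : Plane) (g 0) := by
    conv_lhs => rw [hr]
    rw [inner_add_right]
    congr 1
    exact g.linearIsometryEquiv.inner_map_map _ _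
  rw [euclidRep_apply, Equiv.symm_apply_apply, hin]
  rw [mul_comm (Complex.exp _) ((a : Amp κ) k), mul_assoc, ← Complex.exp_add]
  congr 2
  push_cast; ring

/-! ### The eigenspace for periodic boundary conditions -/

/-- The eigenspace `E_{κ²}(Ω̃) = Fix B_P` of the waves that are `2π`-periodic in both coordinates:
the elements of `E_{κ²}(ℝ²)` fixed by `B_P`. -/
def periodicEigenspace (κ : ℝ) : Submodule ℝ (eigenspace κ) :=
  Representation.invariants ((euclidRep κ).comp BP.subtype)

lemma mem_periodicEigenspace {κ : ℝ} {a : eigenspace κ} :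
    a ∈ periodicEigenspace κ ↔ ∀ b ∈ BP, euclidRep κ b a = a := by
  simp [periodicEigenspace, Representation.mem_invariants]

lemma euclidRep_mem_periodic {κ : ℝ} {g : E2} (hg : g ∈ squareEuclidean) {a : eigenspace κ}
    (ha : a ∈ periodicEigenspace κ) : euclidRep κ g a ∈ periodicEigenspace κ := by
  rw [mem_periodicEigenspace] at ha ⊢
  intro b hb
  have h : g⁻¹ * b * g ∈ BP := by
    simpa using conj_mem_BP_of_mem (inv_mem hg) hb
  have h' := congrArg (euclidRep κ g) (ha _ h)
  rw [← Module.End.mul_apply, ← map_mul] at h' ⊢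
  rw [← h']
  congr 2
  group

/-- The action of the translations and the symmetries of the square on the periodic waves. -/
def squareRep (κ : ℝ) : Representation ℝ squareEuclidean (periodicEigenspace κ) where
  toFun g := (euclidRep κ (g : E2)).restrict (fun _ ha => euclidRep_mem_periodic g.2 ha)
  map_one' := by
    ext1 a; apply Subtype.ext
    change euclidRep κ 1 a = a
    rw [map_one]; rfl
  map_mul' g h := by
    ext1 a; apply Subtype.ext
    change euclidRep κ (g * h : E2) a = euclidRep κ g (euclidRep κ h a)
    rw [map_mul]; rfl

/-- The representation of `D̃₄ ⋉ T²` on `E_{κ²}(Ω̃)`. -/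
def periodicRep (κ : ℝ) : Representation ℝ D4T2 (periodicEigenspace κ) :=
  QuotientGroup.lift (BP.subgroupOf squareEuclidean) (squareRep κ) (by
    intro b hb
    ext1 a; apply Subtype.ext
    exact mem_periodicEigenspace.mp a.2 _ hb)

lemma periodicRep_mk {κ : ℝ} (g : squareEuclidean) (a : periodicEigenspace κ) :
    (periodicRep κ (g : D4T2) a : eigenspace κ) = euclidRep κ (g : E2) a := rfl

/-! ### Equivariant maps -/

/-- A (nonlinear) map commuting with a representation. -/
def Equivariant {G V : Type*} [Monoid G] [AddCommGroup V] [Module ℝ V]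
    (ρ : Representation ℝ G V) (F : V → V) : Prop :=
  ∀ g v, F (ρ g v) = ρ g (F v)

/-- A (continuous) homogeneous polynomial map of degree `p`. -/
def IsHomogeneousPolynomial {V : Type*} [NormedAddCommGroup V] [NormedSpace ℝ V]
    (p : ℕ) (F : V → V) : Prop :=
  ∃ M : ContinuousMultilinearMap ℝ (fun _ : Fin p => V) V, ∀ v, F v = M (fun _ => v)

end HiddenSymmetry

end

/-! Expand fields in plane waves. Irreducibility makes the integer wave vectors of length κ a single
nonempty orbit of the square (`exists_square_linear_eq`), so `Ft` is determined by one scalar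
function f, its amplitude at a lattice point k. Up to summability, an equivariant map on all fields
amounts to a component at k that picks up the right phase under translations, is conjugated by the
rotation through π, and is invariant under the reflection σ in the line of k.

In general σ does not preserve the lattice. Let P keep the lattice amplitudes and let P' keep only
those on the cross of k, the four vectors obtained from k by right-angle rotations. The extended
component is a ↦ f(Pa) + f(Pσa) - f(P'a). Applying σ swaps the first two terms. The third is
invariant, because on the cross σ acts on a given field like a translation orthogonal to k
(`toCross_pull_axialReflection`). If a is periodic, Pσa = P'σa, since σ moves no other lattice
vector to a lattice vector; this rests on the irrationality of √2 (`mem_cross_of_axialReflection`).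
The last two terms then cancel and f(a) remains. The component at j is obtained by moving j to k
with any isometry.

The components at the uncountably many j must be summable when f is smooth. By
`exists_separating_translation`, f vanishes on fields with no amplitude on the cross
(`eq_zero_of_cross`). Hadamard's lemma then gives f(v) = G(v)(πv) with G smooth and π the
restriction to the cross. The cross sums over all j add up to 4‖a‖, G is evaluated along a bounded
family, and superposition by G is smooth on bounded families; hence the extension is smooth into ℓ¹
(`exists_contDiff_apply_family`). The polynomial case follows because a smooth map homogeneous of
degree p is polynomial. -/

open Filter Topology

/-! ### Smoothness of superposition operators on bounded continuous functions. -/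

section Superposition

open BoundedContinuousFunction

section Continuous

variable {X V W : Type} [TopologicalSpace X] [NormedAddCommGroup V] [ProperSpace V]
  [NormedAddCommGroup W]

/-- The superposition operator `u ↦ g ∘ u` on bounded continuous functions. -/
noncomputable def superpose (g : V → W) (hg : Continuous g) (u : X →ᵇ V) : X →ᵇ W :=
  BoundedContinuousFunction.mkOfBound ⟨fun x => g (u x), hg.comp u.continuous⟩
    (Classical.choose (Metric.isBounded_iff.mp
      ((isCompact_closedBall (0 : V) ‖u‖).image hg).isBounded))
    (fun x y => Classical.choose_spec (Metric.isBounded_iff.mp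
      ((isCompact_closedBall (0 : V) ‖u‖).image hg).isBounded)
      (Set.mem_image_of_mem g (by simpa using u.norm_coe_le_norm x))
      (Set.mem_image_of_mem g (by simpa using u.norm_coe_le_norm y)))

@[simp]
lemma superpose_apply (g : V → W) (hg : Continuous g) (u : X →ᵇ V) (x : X) :
    superpose g hg u x = g (u x) := rfl

/-- Uniform continuity of a continuous map near a bounded set. -/
lemma exists_forall_dist_lt_of_norm_le {g : V → W} (hg : Continuous g) (R : ℝ) {ε : ℝ}
    (hε : 0 < ε) :
    ∃ δ > 0, ∀ x y : V, ‖x‖ ≤ R → ‖y - x‖ < δ → ‖g y - g x‖ < ε := by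
  -- The radius is enlarged by one so that the perturbed point, taken within distance `min δ 1`,
  -- stays in the same compact ball.
  have huc := (isCompact_closedBall (0 : V) (R + 1)).uniformContinuousOn_of_continuous
    hg.continuousOn
  obtain ⟨δ, hδ, h⟩ := Metric.uniformContinuousOn_iff.mp huc ε hε
  refine ⟨min δ 1, lt_min hδ one_pos, fun x y hx hxy => ?_⟩
  have hy : ‖y‖ ≤ R + 1 := by
    calc ‖y‖ = ‖x + (y - x)‖ := by congr 1; abel
      _ ≤ ‖x‖ + ‖y - x‖ := norm_add_le _ _
      _ ≤ R + 1 := add_le_add hx (hxy.le.trans (min_le_right _ _))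
  rw [← dist_eq_norm]
  refine h y (by simpa using hy) x (by simpa using hx.trans (by linarith)) ?_
  rw [dist_eq_norm]
  exact hxy.trans_le (min_le_left _ _)

lemma continuous_superpose (g : V → W) (hg : Continuous g) :
    Continuous (superpose (X := X) g hg) := by
  rw [Metric.continuous_iff]
  intro u ε hε
  obtain ⟨δ, hδ, h⟩ := exists_forall_dist_lt_of_norm_le hg ‖u‖ (half_pos hε)
  refine ⟨δ, hδ, fun v hv => ?_⟩
  refine lt_of_le_of_lt ((BoundedContinuousFunction.dist_le (half_pos hε).le).mpr fun x => ?_)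
    (half_lt_self hε)
  rw [dist_eq_norm]
  refine (h (u x) (v x) (u.norm_coe_le_norm x) ?_).le
  rw [← dist_eq_norm]
  exact (BoundedContinuousFunction.dist_coe_le_dist x).trans_lt hv

end Continuous

variable {X V W : Type} [TopologicalSpace X] [NormedAddCommGroup V] [NormedSpace ℝ V]
  [NormedAddCommGroup W] [NormedSpace ℝ W]

/-- Pointwise application of a bounded family of continuous linear maps. -/
noncomputable def pointwiseApply :
    (X →ᵇ (V →L[ℝ] W)) →L[ℝ] (X →ᵇ V) →L[ℝ] (X →ᵇ W) :=
  LinearMap.mkContinuous₂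
    (LinearMap.mk₂ ℝ
      (fun (A : X →ᵇ (V →L[ℝ] W)) (u : X →ᵇ V) =>
        BoundedContinuousFunction.ofNormedAddCommGroup (fun x => A x (u x))
        (A.continuous.clm_apply u.continuous) (‖A‖ * ‖u‖)
        (fun x => (A x).le_of_opNorm_le_of_le (A.norm_coe_le_norm x) (u.norm_coe_le_norm x)))
      (fun A B u => by ext x; simp) (fun c A u => by ext x; simp)
      (fun A u v => by ext x; simp) (fun c A u => by ext x; simp))
    1 (fun A u => (BoundedContinuousFunction.norm_le (by positivity)).mpr fun x => by
      rw [one_mul]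
      exact (A x).le_of_opNorm_le_of_le (A.norm_coe_le_norm x) (u.norm_coe_le_norm x))

@[simp]
lemma pointwiseApply_apply (A : X →ᵇ (V →L[ℝ] W)) (u : X →ᵇ V) (x : X) :
    pointwiseApply A u x = A x (u x) := rfl

/-- The mean value inequality is applied at each point x. The estimate is uniform in x because
`fderiv ℝ g` is uniformly continuous near the bounded range of u. -/
lemma hasFDerivAt_superpose [ProperSpace V] {g : V → W} (hg : ContDiff ℝ ∞ g)
    (hg' : Continuous (fderiv ℝ g)) (u : X →ᵇ V) :
    HasFDerivAt (superpose (X := X) g hg.continuous)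
      (pointwiseApply (superpose (fderiv ℝ g) hg' u)) u := by
  rw [hasFDerivAt_iff_isLittleO_nhds_zero, Asymptotics.isLittleO_iff]
  intro ε hε
  obtain ⟨δ, hδ, h⟩ := exists_forall_dist_lt_of_norm_le hg' ‖u‖ hε
  filter_upwards [Metric.ball_mem_nhds (0 : X →ᵇ V) hδ] with v hv
  rw [mem_ball_zero_iff] at hv
  refine (BoundedContinuousFunction.norm_le (by positivity)).mpr fun x => ?_
  have hvx : ‖v x‖ ≤ ‖v‖ := v.norm_coe_le_norm x
  have key := (convex_ball (u x) δ).norm_image_sub_le_of_norm_fderiv_le' (𝕜 := ℝ) (f := g)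
    (φ := fderiv ℝ g (u x)) (C := ε) (x := u x) (y := u x + v x)
    (fun y _ => (hg.differentiable (by simp)).differentiableAt)
    (fun y hy => (h (u x) y (u.norm_coe_le_norm x) (by simpa [dist_eq_norm] using hy)).le)
    (Metric.mem_ball_self hδ) (by simpa [dist_eq_norm] using hvx.trans_lt hv)
  simp only [add_sub_cancel_left] at key
  simpa using key.trans (mul_le_mul_of_nonneg_left hvx hε.le)

/-- The derivative is again a superposition operator, now by `fderiv ℝ g`, so the induction on n
must leave the target space W free. -/
theorem contDiff_superpose_nat [ProperSpace V] (n : ℕ) :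
    ∀ {W : Type} [NormedAddCommGroup W] [NormedSpace ℝ W] {g : V → W} (hg : ContDiff ℝ ∞ g),
      ContDiff ℝ n (superpose (X := X) g hg.continuous) := by
  induction n with
  | zero =>
    intro W _ _ g hg
    exact contDiff_zero.mpr (continuous_superpose g hg.continuous)
  | succ n ih =>
    intro W _ _ g hg
    have hg' : ContDiff ℝ ∞ (fderiv ℝ g) := hg.fderiv_right (by simp)
    refine contDiff_succ_iff_hasFDerivAt.mpr ⟨fun u => pointwiseApply
      (superpose (fderiv ℝ g) hg'.continuous u), ?_, hasFDerivAt_superpose hg hg'.continuous⟩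
    exact pointwiseApply.contDiff.comp (ih hg')

/-- The superposition operator of a smooth map is smooth. -/
theorem contDiff_superpose [ProperSpace V] {g : V → W} (hg : ContDiff ℝ ∞ g) :
    ContDiff ℝ ∞ (superpose (X := X) g hg.continuous) :=
  contDiff_infty.mpr fun n => contDiff_superpose_nat n hg

end Superposition

/-! ### Hadamard's lemma relative to a linear map. -/

section Hadamard

open BoundedContinuousFunction

variable {V W : Type} [NormedAddCommGroup V] [NormedSpace ℝ V] [NormedAddCommGroup W]
  [NormedSpace ℝ W]

/-- Integration over the unit interval. -/
noncomputable def unitIntegral : (ℝ →ᵇ W) →L[ℝ] W :=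
  LinearMap.mkContinuous
    { toFun := fun u => ∫ t in (0 : ℝ)..1, u t
      map_add' := fun u v => intervalIntegral.integral_add
        (u.continuous.intervalIntegrable _ _) (v.continuous.intervalIntegrable _ _)
      map_smul' := fun c u => intervalIntegral.integral_smul c u }
    1 (fun u => by
      simpa using intervalIntegral.norm_integral_le_of_norm_le_const
        (f := u) (a := 0) (b := 1) (C := ‖u‖) (fun t _ => u.norm_coe_le_norm t))

lemma norm_add_clamp_smul_le (v w : V) (t : ℝ) :
    ‖v + (max 0 (min t 1)) • w‖ ≤ ‖v‖ + ‖w‖ := by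
  refine (norm_add_le _ _).trans (add_le_add_right ?_ _)
  rw [norm_smul, Real.norm_of_nonneg (le_max_left _ _)]
  exact mul_le_of_le_one_left (norm_nonneg _) (max_le zero_le_one (min_le_right _ _))

/-- The segment from `v - π v` to `v`, prolonged by constants. -/
noncomputable def clampedSegment (π : V →L[ℝ] V) : V →L[ℝ] (ℝ →ᵇ V) :=
  LinearMap.mkContinuous
    { toFun := fun v => BoundedContinuousFunction.ofNormedAddCommGroup
        (fun t : ℝ => (v - π v) + (max 0 (min t 1)) • π v) (by fun_prop)
        (‖v - π v‖ + ‖π v‖) (fun t => norm_add_clamp_smul_le _ _ t)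
      map_add' := fun v w => by
        ext t; simp; module
      map_smul' := fun c v => by
        ext t; simp; module }
    (‖ContinuousLinearMap.id ℝ V - π‖ + ‖π‖) (fun v =>
      (BoundedContinuousFunction.norm_le (by positivity)).mpr fun t =>
      (norm_add_clamp_smul_le _ _ t).trans (by
        rw [add_mul]
        exact add_le_add ((ContinuousLinearMap.id ℝ V - π).le_opNorm v) (π.le_opNorm v)))

lemma clampedSegment_apply (π : V →L[ℝ] V) (v : V) (t : ℝ) :
    clampedSegment π v t = (v - π v) + (max 0 (min t 1)) • π v := rfl

/-- Hadamard's lemma: a smooth function vanishing at all points `v - π v` is a smooth multiple of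
`π`. -/
theorem exists_contDiff_eq_apply [ProperSpace V] [CompleteSpace W] {f : V → W}
    (hf : ContDiff ℝ ∞ f) (π : V →L[ℝ] V)
    (h0 : ∀ v, f (v - π v) = 0) :
    ∃ G : V → V →L[ℝ] W, ContDiff ℝ ∞ G ∧ ∀ v, f v = G v (π v) := by
  have hf' : ContDiff ℝ ∞ (fderiv ℝ f) := hf.fderiv_right (by simp)
  -- G(v) is the mean of the derivative of f over the segment from v - πv to v. Clamping makes the
  -- segment a bounded function on ℝ, so G is a composition of smooth maps and no differentiation
  -- under the integral is needed.
  refine ⟨fun v => unitIntegral (superpose (fderiv ℝ f) hf'.continuous (clampedSegment π v)),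
    (unitIntegral (W := V →L[ℝ] W)).contDiff.comp ((contDiff_superpose hf').comp (clampedSegment π).contDiff),
    fun v => ?_⟩
  have hderiv : ∀ t ∈ Set.uIcc (0 : ℝ) 1,
      HasDerivAt (fun t : ℝ => f ((v - π v) + t • π v))
        (fderiv ℝ f ((v - π v) + t • π v) (π v)) t := by
    intro t _
    have h1 : HasDerivAt (fun t : ℝ => (v - π v) + t • π v) (π v) t := by
      simpa using ((hasDerivAt_id t).smul_const (π v)).const_add (v - π v)
    exact ((hf.differentiable (by simp)).differentiableAt.hasFDerivAt).comp_hasDerivAt t h1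
  have hcont : Continuous fun t : ℝ => fderiv ℝ f ((v - π v) + t • π v) :=
    hf'.continuous.comp (by fun_prop)
  have hint := intervalIntegral.integral_eq_sub_of_hasDerivAt hderiv
    ((hcont.clm_apply continuous_const).intervalIntegrable _ _)
  have hfv : f v = ∫ t in (0 : ℝ)..1, fderiv ℝ f ((v - π v) + t • π v) (π v) := by
    rw [hint]; simp [h0]
  rw [hfv]
  change _ = (∫ t in (0 : ℝ)..1,
    superpose (fderiv ℝ f) hf'.continuous (clampedSegment π v) t) (π v)
  rw [ContinuousLinearMap.intervalIntegral_apply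
    ((superpose (fderiv ℝ f) hf'.continuous (clampedSegment π v)).continuous.intervalIntegrable _ _)]
  refine intervalIntegral.integral_congr fun t ht => ?_
  rw [Set.uIcc_of_le zero_le_one] at ht
  simp [clampedSegment_apply, min_eq_left ht.2, max_eq_right ht.1]

end Hadamard

/-! ### Smooth maps into ℓ¹ from bounded and summable families. -/

section SummableFamilies

open BoundedContinuousFunction

variable {ι E V : Type} [TopologicalSpace ι] [NormedAddCommGroup E]
  [NormedSpace ℝ E] [NormedAddCommGroup V] [NormedSpace ℝ V]

/-- A uniformly bounded family of linear maps, as a linear map to the bounded functions. -/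
noncomputable def boundedFamily [DiscreteTopology ι] (Q : ι → E →L[ℝ] V) (C : ℝ) (hC : 0 ≤ C)
    (hQ : ∀ i a, ‖Q i a‖ ≤ C * ‖a‖) : E →L[ℝ] (ι →ᵇ V) :=
  LinearMap.mkContinuous
    { toFun := fun a => BoundedContinuousFunction.ofNormedAddCommGroupDiscrete
        (fun i => Q i a) (C * ‖a‖) (fun i => hQ i a)
      map_add' := fun a b => by ext1 i; exact map_add (Q i) a b
      map_smul' := fun c a => by ext1 i; exact map_smul (Q i) c a }
    C (fun a => (BoundedContinuousFunction.norm_le (by positivity)).mpr fun i => hQ i a)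

/-- The pairing of a bounded family of linear forms with a summable family of linear maps. -/
noncomputable def summablePairing (S : ι → E →L[ℝ] V) (D : ℝ)
    (hS : ∀ a, Summable fun i => ‖S i a‖) (hD : ∀ a, ∑' i, ‖S i a‖ ≤ D * ‖a‖) :
    (ι →ᵇ (V →L[ℝ] ℂ)) →L[ℝ] E →L[ℝ] lp (fun _ : ι => ℂ) 1 :=
  have hle (A : ι →ᵇ (V →L[ℝ] ℂ)) (a : E) (i : ι) : ‖A i (S i a)‖ ≤ ‖A‖ * ‖S i a‖ :=
    (A i).le_of_opNorm_le (A.norm_coe_le_norm i) _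
  have hsum (A : ι →ᵇ (V →L[ℝ] ℂ)) (a : E) : Summable fun i => ‖A i (S i a)‖ :=
    ((hS a).mul_left ‖A‖).of_nonneg_of_le (fun _ => norm_nonneg _) (hle A a)
  LinearMap.mkContinuous₂
    (LinearMap.mk₂ ℝ
      (fun (A : ι →ᵇ (V →L[ℝ] ℂ)) (a : E) =>
        (⟨fun i => A i (S i a), (memℓp_gen_iff (by simp)).mpr (by simpa using hsum A a)⟩ :
          lp (fun _ : ι => ℂ) 1))
      (fun A B a => lp.ext (funext fun i => rfl))
      (fun c A a => lp.ext (funext fun i => rfl))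
      (fun A a b => lp.ext (funext fun i => by
        change A i (S i (a + b)) = A i (S i a) + A i (S i b)
        rw [map_add, map_add]))
      (fun c A a => lp.ext (funext fun i => by
        change A i (S i (c • a)) = c • A i (S i a)
        rw [map_smul, map_smul])))
    D (fun A a => by
      have h := (hsum A a).tsum_le_tsum (hle A a) ((hS a).mul_left ‖A‖)
      rw [tsum_mul_left] at h
      refine (le_of_eq ?_).trans (h.trans ((mul_le_mul_of_nonneg_left (hD a)
        (norm_nonneg A)).trans_eq (by ring)))
      refine (lp.norm_eq_tsum_rpow (by simp) _).trans ?_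
      simp)

@[simp]
lemma summablePairing_apply (S : ι → E →L[ℝ] V) (D : ℝ)
    (hS : ∀ a, Summable fun i => ‖S i a‖) (hD : ∀ a, ∑' i, ‖S i a‖ ≤ D * ‖a‖)
    (A : ι →ᵇ (V →L[ℝ] ℂ)) (a : E) (i : ι) :
    summablePairing S D hS hD A a i = A i (S i a) := rfl

/-- The argument enters twice: through the bounded family fed to G, and as the linear factor that
supplies summability. -/
lemma contDiff_pairing_superpose [ProperSpace V] {F L : Type} [NormedAddCommGroup F]
    [NormedSpace ℝ F] [NormedAddCommGroup L] [NormedSpace ℝ L] (B : (ι →ᵇ F) →L[ℝ] E →L[ℝ] L)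
    (R : E →L[ℝ] (ι →ᵇ V)) {G : V → F} (hG : ContDiff ℝ ∞ G) :
    ContDiff ℝ ∞ fun a => B (superpose G hG.continuous (R a)) a :=
  (B.contDiff.comp ((contDiff_superpose hG).comp R.contDiff)).clm_apply contDiff_id

/-- A smooth function applied to a bounded family of linear maps gives a smooth map to `ℓ¹` if the
function vanishes at all points `v - π v` and the composition of the family with `π` is
summable. -/
theorem exists_contDiff_apply_family [DiscreteTopology ι] [ProperSpace V]
    (Q : ι → E →L[ℝ] V) {C D : ℝ} (hC : 0 ≤ C) (hQ : ∀ i a, ‖Q i a‖ ≤ C * ‖a‖) (π : V →L[ℝ] V)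
    (hS : ∀ a, Summable fun i => ‖π (Q i a)‖) (hD : ∀ a, ∑' i, ‖π (Q i a)‖ ≤ D * ‖a‖) {f : V → ℂ} (hf : ContDiff ℝ ∞ f)
    (h0 : ∀ v, f (v - π v) = 0) :
    ∃ T : E → lp (fun _ : ι => ℂ) 1, ContDiff ℝ ∞ T ∧ ∀ a i, T a i = f (Q i a) := by
  obtain ⟨G, hG, hfG⟩ := exists_contDiff_eq_apply hf π h0
  refine ⟨_, contDiff_pairing_superpose (summablePairing (fun i => π.comp (Q i)) D hS hD)
    (boundedFamily Q C hC hQ) hG, fun a i => ?_⟩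
  rw [hfG]
  exact summablePairing_apply (fun i => π.comp (Q i)) D hS hD
    (superpose G hG.continuous (boundedFamily Q C hC hQ a)) a i

end SummableFamilies

/-- A smooth map that is homogeneous of degree `p` is a homogeneous polynomial map. -/
theorem HiddenSymmetry.isHomogeneousPolynomial_of_contDiff {V : Type*} [NormedAddCommGroup V]
    [NormedSpace ℝ V] {F : V → V} (hF : ContDiff ℝ ∞ F) (p : ℕ)
    (hhom : ∀ (t : ℝ) v, F (t • v) = t ^ p • F v) : IsHomogeneousPolynomial p F := by
  -- The candidate is the Taylor term of order p at 0. On the line through v the map is t ↦ t^p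
  -- F(v), whose p-th derivative is p! F(v).
  refine ⟨((p.factorial : ℝ)⁻¹) • iteratedFDeriv ℝ p F 0, fun v => ?_⟩
  have h1 := (ContinuousLinearMap.toSpanSingleton ℝ v).iteratedFDeriv_comp_right
    (hF.of_le (m := p) (by exact_mod_cast le_top)) (0 : ℝ) le_rfl
  have h2 : iteratedDeriv p (F ∘ ContinuousLinearMap.toSpanSingleton ℝ v) 0 =
      iteratedFDeriv ℝ p F 0 (fun _ => v) := by
    rw [iteratedDeriv, h1]
    simp
  have h3 : F ∘ ContinuousLinearMap.toSpanSingleton ℝ v = fun t : ℝ => t ^ p • F v := by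
    funext t; simp [hhom]
  have h4 : iteratedDeriv p (fun t : ℝ => t ^ p • F v) 0 = (p.factorial : ℝ) • F v := by
    have h := iteratedDeriv_smul_const (n := p) (f := fun t : ℝ => t ^ p) (x := 0)
      (by fun_prop) (F v)
    refine h.trans ?_
    simp [Nat.descFactorial_self]
  have hp : (p.factorial : ℝ) ≠ 0 := by positivity
  simp only [smul_apply]
  rw [← h2, h3, h4, smul_smul, inv_mul_cancel₀ hp, one_smul]

noncomputable section

namespace HiddenSymmetry

/-! ### Geometry of the circle of wave vectors -/

lemma inner_plane (u v : Plane) : (inner ℝ u v : ℝ) = u 0 * v 0 + u 1 * v 1 := by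
  simp [PiLp.inner_apply, Fin.sum_univ_two, mul_comm]

lemma Circ.sq_add_sq {κ : ℝ} (k : Circ κ) : (k : Plane) 0 ^ 2 + (k : Plane) 1 ^ 2 = κ ^ 2 := by
  have h : ‖(k : Plane)‖ ^ 2 = κ ^ 2 := by simp
  rw [← h, EuclideanSpace.norm_sq_eq]
  simp [Fin.sum_univ_two]

lemma Circ.ext_coord {κ : ℝ} {j k : Circ κ} (h0 : (j : Plane) 0 = (k : Plane) 0)
    (h1 : (j : Plane) 1 = (k : Plane) 1) : j = k := by
  ext i; fin_cases i <;> assumption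

lemma Circ.neg_coord {κ : ℝ} (k : Circ κ) (i : Fin 2) :
    ((-k : Circ κ) : Plane) i = -(k : Plane) i := rfl

lemma norm_vec_two (x y : ℝ) : ‖(!₂[x, y] : Plane)‖ = √(x ^ 2 + y ^ 2) := by
  simp [EuclideanSpace.norm_eq, Fin.sum_univ_two]

/-- Rotation of a wave vector by a right angle. -/
def quarterTurn {κ : ℝ} (k : Circ κ) : Circ κ :=
  ⟨!₂[-(k : Plane) 1, (k : Plane) 0], by
    have h : ‖(k : Plane)‖ = κ := by simp
    rw [mem_sphere_zero_iff_norm, norm_vec_two, neg_sq, add_comm, k.sq_add_sq, ← h,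
      Real.sqrt_sq (norm_nonneg _)]⟩

@[simp] lemma quarterTurn_zero {κ : ℝ} (k : Circ κ) :
    (quarterTurn k : Plane) 0 = -(k : Plane) 1 := rfl

@[simp] lemma quarterTurn_one {κ : ℝ} (k : Circ κ) :
    (quarterTurn k : Plane) 1 = (k : Plane) 0 := rfl

lemma quarterTurn_quarterTurn {κ : ℝ} (k : Circ κ) : quarterTurn (quarterTurn k) = -k :=
  Circ.ext_coord (by simp) (by simp)

lemma quarterTurn_neg {κ : ℝ} (k : Circ κ) : quarterTurn (-k) = -quarterTurn k :=
  Circ.ext_coord (by simp) (by simp)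

lemma inner_quarterTurn {κ : ℝ} (k : Circ κ) :
    (inner ℝ (quarterTurn k : Plane) (k : Plane) : ℝ) = 0 := by
  rw [inner_plane]; simp; ring

lemma inner_self_circ {κ : ℝ} (k : Circ κ) : (inner ℝ (k : Plane) (k : Plane) : ℝ) = κ ^ 2 := by
  rw [inner_plane, ← k.sq_add_sq]; ring

lemma eq_or_eq_neg_quarterTurn {κ : ℝ} (hκ : 0 < κ) {j k : Circ κ}
    (h : (inner ℝ (j : Plane) (k : Plane) : ℝ) = 0) : j = quarterTurn k ∨ j = -quarterTurn k := by
  rw [inner_plane] at h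
  have hj := j.sq_add_sq
  have hk := k.sq_add_sq
  have hκ2 : κ ^ 2 ≠ 0 := by positivity
  -- This is the determinant of k and j. Orthogonality gives κ² j = c times the quarter turn of k,
  -- and Lagrange's identity gives c = ±κ².
  set c : ℝ := ((j : Plane) 1 * (k : Plane) 0 - (j : Plane) 0 * (k : Plane) 1) with hc
  have h0 : κ ^ 2 * (j : Plane) 0 = c * -(k : Plane) 1 := by
    rw [hc, ← hk]; linear_combination (k : Plane) 0 * h
  have h1 : κ ^ 2 * (j : Plane) 1 = c * (k : Plane) 0 := by
    rw [hc, ← hk]; linear_combination (k : Plane) 1 * h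
  have hc2 : (c - κ ^ 2) * (c + κ ^ 2) = 0 := by
    have : c ^ 2 = κ ^ 2 * κ ^ 2 := by
      rw [hc]
      linear_combination ((k : Plane) 0 ^ 2 + (k : Plane) 1 ^ 2) * hj + κ ^ 2 * hk -
        ((j : Plane) 0 * (k : Plane) 0 + (j : Plane) 1 * (k : Plane) 1) * h
    linear_combination this
  rcases mul_eq_zero.mp hc2 with hc' | hc'
  · have hc' : c = κ ^ 2 := by linarith
    rw [hc'] at h0 h1
    exact Or.inl (Circ.ext_coord (mul_left_cancel₀ hκ2 h0) (mul_left_cancel₀ hκ2 h1))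
  · have hc' : c = -κ ^ 2 := by linarith
    rw [hc'] at h0 h1
    refine Or.inr (Circ.ext_coord (mul_left_cancel₀ hκ2 ?_) (mul_left_cancel₀ hκ2 ?_))
    · rw [Circ.neg_coord, quarterTurn_zero]; linear_combination h0
    · rw [Circ.neg_coord, quarterTurn_one]; linear_combination h1

/-- The four wave vectors obtained from `k` by rotations through right angles. -/
def cross {κ : ℝ} (k : Circ κ) : Set (Circ κ) :=
  {j | j = k ∨ j = -k ∨ j = quarterTurn k ∨ j = -quarterTurn k}

lemma neg_mem_cross {κ : ℝ} {j k : Circ κ} : -j ∈ cross k ↔ j ∈ cross k := by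
  have : ∀ j : Circ κ, j ∈ cross k → -j ∈ cross k := by
    rintro j (rfl | rfl | rfl | rfl) <;> simp [cross]
  exact ⟨fun h => by simpa using this _ h, this j⟩

lemma self_mem_cross {κ : ℝ} (k : Circ κ) : k ∈ cross k := Or.inl rfl

lemma quarterTurn_mem_cross {κ : ℝ} {j k : Circ κ} (h : j ∈ cross k) :
    quarterTurn j ∈ cross k := by
  rcases h with rfl | rfl | rfl | rfl
  · exact Or.inr (Or.inr (Or.inl rfl))
  · exact Or.inr (Or.inr (Or.inr (quarterTurn_neg _)))
  · exact Or.inr (Or.inl (quarterTurn_quarterTurn _))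
  · exact Or.inl (by rw [quarterTurn_neg, quarterTurn_quarterTurn, neg_neg])

lemma rotCirc_coe {κ : ℝ} (L : Plane ≃ₗᵢ[ℝ] Plane) (k : Circ κ) :
    (rotCirc L k : Plane) = L k := rfl

lemma rotCirc_neg {κ : ℝ} (L : Plane ≃ₗᵢ[ℝ] Plane) (k : Circ κ) :
    rotCirc L (-k) = -rotCirc L k := by
  ext1; simp [rotCirc_coe]

lemma rotCirc_quarterTurn {κ : ℝ} (hκ : 0 < κ) (L : Plane ≃ₗᵢ[ℝ] Plane) (k : Circ κ) :
    rotCirc L (quarterTurn k) = quarterTurn (rotCirc L k) ∨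
      rotCirc L (quarterTurn k) = -quarterTurn (rotCirc L k) := by
  apply eq_or_eq_neg_quarterTurn hκ
  rw [rotCirc_coe, rotCirc_coe, L.inner_map_map, inner_quarterTurn]

/-- A vector of the plane in the orthogonal basis `k`, `quarterTurn k`. -/
lemma smul_eq_of_circ {κ : ℝ} (k : Circ κ) (r : Plane) :
    κ ^ 2 • r = (inner ℝ r (k : Plane) : ℝ) • (k : Plane) +
      (inner ℝ r (quarterTurn k : Plane) : ℝ) • (quarterTurn k : Plane) := by
  rw [inner_plane, inner_plane, ← k.sq_add_sq]
  ext i; fin_cases i <;> simp <;> ring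

lemma eq_of_apply_eq {κ : ℝ} (hκ : 0 < κ) {k : Circ κ} {L M : Plane ≃ₗᵢ[ℝ] Plane}
    (h : rotCirc L k = rotCirc M k)
    (h' : rotCirc L (quarterTurn k) = rotCirc M (quarterTurn k)) : L = M := by
  ext1 r
  have e : L k = M k := congrArg Subtype.val h
  have e' : L (quarterTurn k) = M (quarterTurn k) := congrArg Subtype.val h'
  have hr := congrArg L (smul_eq_of_circ k r)
  have hr' := congrArg M (smul_eq_of_circ k r)
  simp only [map_add, map_smul] at hr hr'
  rw [e, e', ← hr'] at hr
  exact smul_right_injective _ (pow_ne_zero 2 hκ.ne') hr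

/-- The reflection in the line spanned by the wave vector `k`. -/
def axialReflection {κ : ℝ} (k : Circ κ) : Plane ≃ₗᵢ[ℝ] Plane := (ℝ ∙ (k : Plane)).reflection

lemma axialReflection_self {κ : ℝ} (k : Circ κ) : rotCirc (axialReflection k) k = k := by
  ext1
  exact Submodule.reflection_mem_subspace_eq_self (Submodule.mem_span_singleton_self _)

lemma axialReflection_quarterTurn {κ : ℝ} (k : Circ κ) :
    rotCirc (axialReflection k) (quarterTurn k) = -quarterTurn k := by
  ext1
  refine Submodule.reflection_mem_subspace_orthogonalComplement_eq_neg
    (Submodule.mem_orthogonal_singleton_iff_inner_left.mpr ?_)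
  exact inner_quarterTurn k

lemma axialReflection_axialReflection {κ : ℝ} (k j : Circ κ) :
    rotCirc (axialReflection k) (rotCirc (axialReflection k) j) = j := by
  ext1
  exact Submodule.reflection_reflection _ _

/-- Adding the expansion of j in the orthogonal basis k, `quarterTurn k` to its reflected image
cancels the component along `quarterTurn k`. -/
lemma axialReflection_coord {κ : ℝ} (k j : Circ κ) (i : Fin 2) :
    κ ^ 2 * (rotCirc (axialReflection k) j : Plane) i =
      2 * (inner ℝ (j : Plane) (k : Plane) : ℝ) * (k : Plane) i - κ ^ 2 * (j : Plane) i := by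
  have h := smul_eq_of_circ k (j : Plane)
  have h' := congrArg (axialReflection k) h
  have e : axialReflection k k = k := congrArg Subtype.val (axialReflection_self k)
  have e' : axialReflection k (quarterTurn k) = -(quarterTurn k : Plane) :=
    congrArg Subtype.val (axialReflection_quarterTurn k)
  simp only [map_add, map_smul, e, e'] at h'
  have hi := congrArg (fun v : Plane => v i) h
  have hi' := congrArg (fun v : Plane => v i) h'
  simp at hi hi'
  rw [rotCirc_coe]
  linear_combination hi + hi'

/-- An isometry is determined by the image of one wave vector, up to the axial reflection. -/
lemma eq_or_eq_trans_axialReflection {κ : ℝ} (hκ : 0 < κ) {k : Circ κ} {L M : Plane ≃ₗᵢ[ℝ] Plane}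
    (h : rotCirc L k = rotCirc M k) : L = M ∨ L = (axialReflection k).trans M := by
  have hL := rotCirc_quarterTurn hκ L k
  have hM := rotCirc_quarterTurn hκ M k
  rw [h] at hL
  by_cases he : rotCirc L (quarterTurn k) = rotCirc M (quarterTurn k)
  · exact Or.inl (eq_of_apply_eq hκ h he)
  · refine Or.inr (eq_of_apply_eq hκ (k := k) ?_ ?_)
    · change _ = rotCirc M (rotCirc (axialReflection k) k)
      rw [axialReflection_self, h]
    · change _ = rotCirc M (rotCirc (axialReflection k) (quarterTurn k))
      rw [axialReflection_quarterTurn, rotCirc_neg]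
      rcases hL with hL | hL <;> rcases hM with hM | hM <;> simp_all

/-- The reflection interchanging two wave vectors. -/
def swapReflection {κ : ℝ} (j k : Circ κ) : Plane ≃ₗᵢ[ℝ] Plane :=
  (ℝ ∙ ((j : Plane) - k))ᗮ.reflection

lemma swapReflection_apply {κ : ℝ} (j k : Circ κ) : rotCirc (swapReflection j k) j = k := by
  ext1
  exact Submodule.reflection_sub (by simp)

/-! ### Integer wave vectors -/

/-- The wave vectors with integer coordinates. -/
def latticePoints (κ : ℝ) : Set (Circ κ) := {k | ∀ i, ∃ n : ℤ, (k : Plane) i = n}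

lemma neg_mem_latticePoints {κ : ℝ} {k : Circ κ} : -k ∈ latticePoints κ ↔ k ∈ latticePoints κ := by
  have : ∀ k : Circ κ, k ∈ latticePoints κ → -k ∈ latticePoints κ := fun k hk i => by
    obtain ⟨n, hn⟩ := hk i
    exact ⟨-n, by simp [hn]⟩
  exact ⟨fun h => by simpa using this _ h, this k⟩

lemma cross_subset_latticePoints {κ : ℝ} {k : Circ κ} (hk : k ∈ latticePoints κ) :
    cross k ⊆ latticePoints κ := by
  have hq : quarterTurn k ∈ latticePoints κ := by
    obtain ⟨m, hm⟩ := hk 0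
    obtain ⟨n, hn⟩ := hk 1
    intro i
    fin_cases i
    · exact ⟨-n, by simp [hn]⟩
    · exact ⟨m, by simp [hm]⟩
  rintro j (rfl | rfl | rfl | rfl)
  · exact hk
  · exact neg_mem_latticePoints.mpr hk
  · exact hq
  · exact neg_mem_latticePoints.mpr hq

/-- On a circle, this function separates the orbits of the symmetry group of the square. -/
def squareInvariant {κ : ℝ} (k : Circ κ) : ℝ := ((k : Plane) 0 * (k : Plane) 1) ^ 2

/-- The mirror image of a wave vector in the horizontal axis. -/
def mirror {κ : ℝ} (k : Circ κ) : Circ κ :=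
  ⟨!₂[(k : Plane) 0, -(k : Plane) 1], by
    have h : ‖(k : Plane)‖ = κ := by simp
    rw [mem_sphere_zero_iff_norm, norm_vec_two, neg_sq, k.sq_add_sq, ← h,
      Real.sqrt_sq (norm_nonneg _)]⟩

@[simp] lemma mirror_zero {κ : ℝ} (k : Circ κ) : (mirror k : Plane) 0 = (k : Plane) 0 := rfl

@[simp] lemma mirror_one {κ : ℝ} (k : Circ κ) : (mirror k : Plane) 1 = -(k : Plane) 1 := rfl

/-- The squared coordinates have sum κ² and their product is the invariant, so they are determined
up to order. The eight choices of order and signs form the two crosses. -/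
lemma mem_cross_or_mem_cross_mirror {κ : ℝ} {j k : Circ κ}
    (h : squareInvariant j = squareInvariant k) : j ∈ cross k ∨ j ∈ cross (mirror k) := by
  have hj := j.sq_add_sq
  have hk := k.sq_add_sq
  simp only [squareInvariant] at h
  have key : ((j : Plane) 0 ^ 2 - (k : Plane) 0 ^ 2) * ((j : Plane) 0 ^ 2 - (k : Plane) 1 ^ 2)
      = 0 := by
    linear_combination (j : Plane) 0 ^ 2 * (hj - hk) - h
  rcases mul_eq_zero.mp key with h0 | h0
  · have h0' : (j : Plane) 0 ^ 2 = (k : Plane) 0 ^ 2 := by linarith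
    have h1' : (j : Plane) 1 ^ 2 = (k : Plane) 1 ^ 2 := by linarith
    rcases sq_eq_sq_iff_eq_or_eq_neg.mp h0' with e0 | e0 <;>
      rcases sq_eq_sq_iff_eq_or_eq_neg.mp h1' with e1 | e1
    · exact Or.inl (Or.inl (Circ.ext_coord e0 e1))
    · exact Or.inr (Or.inl (Circ.ext_coord e0 (by simp [e1])))
    · exact Or.inr (Or.inr (Or.inl (Circ.ext_coord (by simp [e0]) (by simp [e1]))))
    · exact Or.inl (Or.inr (Or.inl (Circ.ext_coord (by simp [e0]) (by simp [e1]))))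
  · have h0' : (j : Plane) 0 ^ 2 = (k : Plane) 1 ^ 2 := by linarith
    have h1' : (j : Plane) 1 ^ 2 = (k : Plane) 0 ^ 2 := by linarith
    rcases sq_eq_sq_iff_eq_or_eq_neg.mp h0' with e0 | e0 <;>
      rcases sq_eq_sq_iff_eq_or_eq_neg.mp h1' with e1 | e1
    · exact Or.inr (Or.inr (Or.inr (Or.inl (Circ.ext_coord (by simp [e0]) (by simp [e1])))))
    · exact Or.inl (Or.inr (Or.inr (Or.inr (Circ.ext_coord (by simp [e0]) (by simp [e1])))))
    · exact Or.inl (Or.inr (Or.inr (Or.inl (Circ.ext_coord (by simp [e0]) (by simp [e1])))))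
    · exact Or.inr (Or.inr (Or.inr (Or.inr (Circ.ext_coord (by simp [e0]) (by simp [e1])))))

/-- The hypothesis says that k lies on a symmetry axis of the square, where the two crosses
coincide. -/
lemma mirror_mem_cross {κ : ℝ} {k : Circ κ}
    (h : (k : Plane) 0 * (k : Plane) 1 * ((k : Plane) 0 ^ 2 - (k : Plane) 1 ^ 2) = 0) :
    mirror k ∈ cross k := by
  rcases mul_eq_zero.mp h with h | h
  · rcases mul_eq_zero.mp h with h | h
    · exact Or.inr (Or.inl (Circ.ext_coord (by simp [h]) (by simp)))
    · exact Or.inl (Circ.ext_coord (by simp) (by simp [h]))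
  · rcases sq_eq_sq_iff_eq_or_eq_neg.mp (sub_eq_zero.mp h) with e | e
    · exact Or.inr (Or.inr (Or.inr (Circ.ext_coord (by simp [e]) (by simp [e]))))
    · exact Or.inr (Or.inr (Or.inl (Circ.ext_coord (by simp [e]) (by simp [e]))))

lemma cross_subset_of_mem {κ : ℝ} {j k : Circ κ} (h : j ∈ cross k) : cross j ⊆ cross k := by
  rintro i (rfl | rfl | rfl | rfl)
  · exact h
  · exact neg_mem_cross.mpr h
  · exact quarterTurn_mem_cross h
  · exact neg_mem_cross.mpr (quarterTurn_mem_cross h)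

lemma sq_ne_two_mul_sq {a b : ℤ} (hb : b ≠ 0) : a ^ 2 ≠ 2 * b ^ 2 := by
  intro h
  have h' : ((a : ℝ) / b) ^ 2 = 2 := by
    have hb' : (b : ℝ) ≠ 0 := by exact_mod_cast hb
    rw [div_pow, div_eq_iff (pow_ne_zero 2 hb')]
    exact_mod_cast h
  have habs : |(a : ℝ) / b| = √2 := by rw [← h', Real.sqrt_sq_eq_abs]
  refine irrational_sqrt_two ⟨|(a : ℚ) / b|, ?_⟩
  rw [← habs]
  push_cast
  rfl

/-- A wave vector in the orbit of the lattice point `k` which stays in the orbit under the axial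
reflection at `k` differs from `k` by a rotation through right angles. -/
lemma mem_cross_of_axialReflection {κ : ℝ} (hκ : 0 < κ) {j k : Circ κ} (hk : k ∈ latticePoints κ)
    (hj : squareInvariant j = squareInvariant k)
    (hσ : squareInvariant (rotCirc (axialReflection k) j) = squareInvariant k) : j ∈ cross k := by
  rcases mem_cross_or_mem_cross_mirror hj with h | h
  · exact h
  -- It remains to put k on a symmetry axis. If k has polar angle θ, then j has angle -θ and its
  -- reflection 3θ, modulo right angles. Staying in the orbit means 3θ ≡ ±θ modulo π/2, so θ is a
  -- multiple of π/8.
  refine cross_subset_of_mem (mirror_mem_cross ?_) h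
  obtain ⟨m, hm⟩ := hk 0
  obtain ⟨n, hn⟩ := hk 1
  have h0 := axialReflection_coord k j 0
  have h1 := axialReflection_coord k j 1
  have hκk := k.sq_add_sq
  rw [inner_plane] at h0 h1
  rw [hm, hn] at h0 h1 hκk ⊢
  simp only [squareInvariant, hm, hn] at hσ
  set s := (rotCirc (axialReflection k) j : Plane)
  have hN : ((m : ℝ) ^ 2 + n ^ 2) ≠ 0 := by rw [hκk]; positivity
  rw [← hκk] at h0 h1
  have hprod : (((m : ℝ) ^ 2 + n ^ 2) * s 0 * (((m : ℝ) ^ 2 + n ^ 2) * s 1)) ^ 2 =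
      (m * n) ^ 2 * (((m : ℝ) ^ 2 + n ^ 2) ^ 2) ^ 2 := by
    linear_combination ((m : ℝ) ^ 2 + n ^ 2) ^ 4 * hσ
  have hfac : (((m : ℝ) ^ 2 + n ^ 2) * s 0 * (((m : ℝ) ^ 2 + n ^ 2) * s 1)) ^ 2 =
      (m * n) ^ 2 * ((m ^ 2 - 3 * n ^ 2) * (3 * m ^ 2 - n ^ 2)) ^ 2 := by
    rw [h0, h1]
    rcases h with rfl | rfl | rfl | rfl <;>
      simp only [Circ.neg_coord, quarterTurn_zero, quarterTurn_one, mirror_zero, mirror_one, hm,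
        hn] <;> ring
  rw [hprod] at hfac
  by_cases hmn : (m : ℝ) * n = 0
  · rw [hmn, zero_mul]
  rcases sq_eq_sq_iff_eq_or_eq_neg.mp (mul_left_cancel₀ (pow_ne_zero 2 hmn) hfac) with e | e
  -- Odd multiples of π/8: the slope would be ±1 ± √2, impossible for integers m and n.
  · have e1 : ((m : ℝ) ^ 2 - n ^ 2) ^ 2 = (2 * (m * n)) ^ 2 := by linear_combination -e / 2
    have hn0 : n ≠ 0 := by rintro rfl; simp at hmn
    exfalso
    rcases sq_eq_sq_iff_eq_or_eq_neg.mp e1 with e2 | e2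
    · refine sq_ne_two_mul_sq (a := m - n) hn0 ?_
      have : ((m : ℝ) - n) ^ 2 = 2 * n ^ 2 := by linear_combination e2
      exact_mod_cast this
    · refine sq_ne_two_mul_sq (a := m + n) hn0 ?_
      have : ((m : ℝ) + n) ^ 2 = 2 * n ^ 2 := by linear_combination e2
      exact_mod_cast this
  · have e1 : ((m : ℝ) ^ 2 - n ^ 2) ^ 2 = 0 := by linear_combination e / 4
    rw [pow_eq_zero_iff two_ne_zero] at e1
    rw [e1, mul_zero]

/-- There is a translation which leaves invariant all waves in the orbit of the lattice point `k`
except for the ones in `cross k`, and which does not leave invariant the wave `k`. -/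
lemma exists_separating_translation {κ : ℝ} (hκ : 0 < κ) (k : Circ κ) :
    ∃ v : Plane, (∀ j : Circ κ, squareInvariant j = squareInvariant k → j ∉ cross k →
      ∃ n : ℤ, (inner ℝ (j : Plane) v : ℝ) = n * (2 * Real.pi)) ∧
      ¬ ∃ n : ℤ, (inner ℝ (k : Plane) v : ℝ) = n * (2 * Real.pi) := by
  have hκ2 : κ ^ 2 ≠ 0 := by positivity
  have hπ := Real.pi_ne_zero
  by_cases hq : (k : Plane) 0 * (k : Plane) 1 * ((k : Plane) 0 ^ 2 - (k : Plane) 1 ^ 2) = 0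
  -- On a symmetry axis the orbit is just the cross, so any translation with nontrivial phase at k
  -- serves; this one has phase π.
  · refine ⟨(Real.pi / κ ^ 2) • (k : Plane), fun j hj hjk => ?_, ?_⟩
    · rcases mem_cross_or_mem_cross_mirror hj with h | h
      · exact absurd h hjk
      · exact absurd (cross_subset_of_mem (mirror_mem_cross hq) h) hjk
    · rintro ⟨n, hn⟩
      rw [inner_smul_right, inner_self_circ, div_mul_cancel₀ _ hκ2] at hn
      have h2 : (1 : ℝ) = n * 2 := mul_right_cancel₀ hπ (by linear_combination hn)
      have h3 : (1 : ℤ) = n * 2 := by exact_mod_cast h2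
      omega
  -- A full wavelength along a vector of the mirror cross fixes every wave of that cross, as the
  -- inner products there are 0 or ±κ².
  have hcross : ∀ c : Circ κ, c ∈ cross (mirror k) → ∀ j : Circ κ,
      squareInvariant j = squareInvariant k → j ∉ cross k → ∃ n : ℤ,
        (inner ℝ (j : Plane) ((2 * Real.pi / κ ^ 2) • (c : Plane)) : ℝ) = n * (2 * Real.pi) := by
    intro c hc j hj hjk
    have hint : ∃ n : ℤ, (inner ℝ (j : Plane) (c : Plane) : ℝ) = n * κ ^ 2 := by
      have hm := (mirror k).sq_add_sq
      rcases mem_cross_or_mem_cross_mirror hj with h | h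
      · exact absurd h hjk
      · rw [← hm, inner_plane]
        rcases h with rfl | rfl | rfl | rfl <;> rcases hc with rfl | rfl | rfl | rfl <;>
          simp only [Circ.neg_coord, quarterTurn_zero, quarterTurn_one] <;>
          first
          | exact ⟨1, by push_cast; ring1⟩
          | exact ⟨-1, by push_cast; ring1⟩
          | exact ⟨0, by push_cast; ring1⟩
    obtain ⟨n, hn⟩ := hint
    refine ⟨n, ?_⟩
    rw [inner_smul_right, hn]
    field_simp
  -- Were two such orthogonal translations both trivial at k, then cos 2θ and sin 2θ would be
  -- integers, θ being the polar angle of k. One of them would vanish, placing k on a symmetry axis.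
  by_contra hcon
  push Not at hcon
  obtain ⟨c, hc⟩ := hcon _ (hcross (mirror k) (Or.inl rfl))
  obtain ⟨d, hd⟩ := hcon _ (hcross (quarterTurn (mirror k)) (Or.inr (Or.inr (Or.inl rfl))))
  rw [inner_smul_right, inner_plane] at hc hd
  simp only [mirror_zero, mirror_one, quarterTurn_zero, quarterTurn_one] at hc hd
  have hk2 := k.sq_add_sq
  set x := (k : Plane) 0
  set y := (k : Plane) 1
  have hc' : x ^ 2 - y ^ 2 = c * κ ^ 2 := by
    field_simp at hc
    linear_combination hc
  have hd' : 2 * (x * y) = d * κ ^ 2 := by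
    field_simp at hd
    linear_combination hd
  have hcd : (c : ℝ) ^ 2 + (d : ℝ) ^ 2 = 1 := by
    have : ((c : ℝ) ^ 2 + (d : ℝ) ^ 2) * (κ ^ 2) ^ 2 = 1 * (κ ^ 2) ^ 2 := by
      linear_combination -(c * κ ^ 2 + x ^ 2 - y ^ 2) * hc' - (d * κ ^ 2 + 2 * (x * y)) * hd' +
        (x ^ 2 + y ^ 2 + κ ^ 2) * hk2
    exact mul_right_cancel₀ (pow_ne_zero 2 hκ2) this
  have hcd' : c ^ 2 + d ^ 2 = 1 := by exact_mod_cast hcd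
  have h0 : c = 0 ∨ d = 0 := by
    by_contra! h
    have h1 : 0 < c ^ 2 := by have := h.1; positivity
    have h2 : 0 < d ^ 2 := by have := h.2; positivity
    omega
  apply hq
  rcases h0 with rfl | rfl
  · rw [hc']; simp
  · have : x * y = 0 := by simpa using hd'
    rw [this, zero_mul]

end HiddenSymmetry

end

noncomputable section

namespace HiddenSymmetry

/-! ### Continuous linear maps between the eigenspaces -/

variable {κ : ℝ}

lemma eigenspace_ext {a b : eigenspace κ} (h : ∀ k, (a : Amp κ) k = (b : Amp κ) k) : a = b :=
  Subtype.ext (lp.ext (funext h))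

lemma periodicEigenspace_ext {a b : periodicEigenspace κ}
    (h : ∀ k, ((a : eigenspace κ) : Amp κ) k = ((b : eigenspace κ) : Amp κ) k) : a = b :=
  Subtype.ext (eigenspace_ext h)

lemma amp_norm_eq (a : Amp κ) : ‖a‖ = ∑' k, ‖a k‖ := by
  simpa using lp.norm_eq_tsum_rpow (p := 1) (by simp) a

lemma memℓp_one_iff {a : Circ κ → ℂ} : Memℓp a 1 ↔ Summable fun k => ‖a k‖ := by
  simpa using memℓp_gen_iff (p := 1) (by simp) (f := a)

lemma amp_summable (a : Amp κ) : Summable fun k => ‖a k‖ := memℓp_one_iff.mp (lp.memℓp a)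

lemma amp_norm_le_of_le {a b : Amp κ} (h : ∀ k, ‖a k‖ ≤ ‖b k‖) : ‖a‖ ≤ ‖b‖ := by
  rw [amp_norm_eq, amp_norm_eq]
  exact (amp_summable a).tsum_le_tsum h (amp_summable b)

/-- The action of the inverse of a linear isometry on the fields. -/
def pull (L : Plane ≃ₗᵢ[ℝ] Plane) : eigenspace κ →L[ℝ] eigenspace κ :=
  (euclidRep κ L.symm.toAffineIsometryEquiv).mkContinuous 1 (fun a => by
    have h : ∀ k, ‖(euclidRep κ L.symm.toAffineIsometryEquiv a : Amp κ) k‖ =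
        ‖(a : Amp κ) (rotCirc L k)‖ := fun k => by
      rw [euclidRep_apply, norm_mul, norm_phase, one_mul]
      rfl
    rw [one_mul, Submodule.coe_norm, Submodule.coe_norm, amp_norm_eq, amp_norm_eq, tsum_congr h]
    exact ((rotCirc L).tsum_eq fun k => ‖(a : Amp κ) k‖).le)

lemma pull_apply (L : Plane ≃ₗᵢ[ℝ] Plane) (a : eigenspace κ) (k : Circ κ) :
    (pull L a : Amp κ) k = (a : Amp κ) (rotCirc L k) := by
  change (euclidRep κ L.symm.toAffineIsometryEquiv a : Amp κ) k = _
  rw [euclidRep_apply]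
  have h : L.symm.toAffineIsometryEquiv (0 : Plane) = 0 := L.symm.map_zero
  rw [h, inner_zero_right]
  simp only [Complex.ofReal_zero, mul_zero, neg_zero, Complex.exp_zero, one_mul]
  rfl

lemma norm_pull_le (L : Plane ≃ₗᵢ[ℝ] Plane) (a : eigenspace κ) : ‖pull L a‖ ≤ ‖a‖ := by
  simpa using (pull L).le_of_opNorm_le (LinearMap.mkContinuous_norm_le _ zero_le_one _) a

lemma translation_apply_amp (v : Plane) (a : eigenspace κ) (k : Circ κ) :
    (euclidRep κ (translation v) a : Amp κ) k =
      Complex.exp (-(Complex.I * (inner ℝ (k : Plane) v : ℝ))) * (a : Amp κ) k := by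
  rw [euclidRep_apply, translation_apply, add_zero]
  rfl

lemma exp_neg_eq_one_iff (x : ℝ) :
    Complex.exp (-(Complex.I * (x : ℂ))) = 1 ↔ ∃ n : ℤ, x = n * (2 * Real.pi) := by
  rw [Complex.exp_eq_one_iff]
  have key : ∀ n : ℤ, -(Complex.I * (x : ℂ)) = n * (2 * Real.pi * Complex.I) ↔
      x = ((-n : ℤ) : ℝ) * (2 * Real.pi) := by
    intro n
    rw [show -(Complex.I * (x : ℂ)) = ((-x : ℝ) : ℂ) * Complex.I by push_cast; ring,
      show (n : ℂ) * (2 * Real.pi * Complex.I) = ((n * (2 * Real.pi) : ℝ) : ℂ) * Complex.I by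
        push_cast; ring, mul_left_inj' Complex.I_ne_zero, Complex.ofReal_inj]
    push_cast
    constructor <;> intro h <;> linarith
  exact ⟨fun ⟨n, hn⟩ => ⟨-n, (key n).mp hn⟩,
    fun ⟨n, hn⟩ => ⟨-n, (key (-n)).mpr (by rwa [neg_neg])⟩⟩

/-- The periodic fields are the ones with integer wave vectors. -/
lemma mem_periodicEigenspace_iff {a : eigenspace κ} :
    a ∈ periodicEigenspace κ ↔ ∀ k, k ∉ latticePoints κ → (a : Amp κ) k = 0 := by
  have inner0 : ∀ k : Circ κ, (inner ℝ (k : Plane) !₂[2 * Real.pi, 0] : ℝ) =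
      (k : Plane) 0 * (2 * Real.pi) := fun k => by rw [inner_plane]; simp
  have inner1 : ∀ k : Circ κ, (inner ℝ (k : Plane) !₂[0, 2 * Real.pi] : ℝ) =
      (k : Plane) 1 * (2 * Real.pi) := fun k => by rw [inner_plane]; simp
  have hπ : (2 * Real.pi) ≠ 0 := by positivity
  rw [mem_periodicEigenspace]
  constructor
  · intro h k hk
    by_contra hak
    have key : ∀ v : Plane, translation v ∈ BP → ∃ n : ℤ,
        (inner ℝ (k : Plane) v : ℝ) = n * (2 * Real.pi) := by
      intro v hv
      rw [← exp_neg_eq_one_iff]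
      have h' := congrArg (fun a : eigenspace κ => (a : Amp κ) k) (h _ hv)
      simp only [translation_apply_amp] at h'
      exact mul_eq_right₀ hak |>.mp h'
    obtain ⟨m, hm⟩ := key _ (Subgroup.subset_closure (Or.inl rfl))
    obtain ⟨n, hn⟩ := key _ (Subgroup.subset_closure (Or.inr rfl))
    rw [inner0] at hm
    rw [inner1] at hn
    refine hk fun i => ?_
    fin_cases i
    · exact ⟨m, mul_right_cancel₀ hπ hm⟩
    · exact ⟨n, mul_right_cancel₀ hπ hn⟩
  · intro h b hb
    have key : ∀ v : Plane, (∀ k ∈ latticePoints κ, ∃ n : ℤ,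
        (inner ℝ (k : Plane) v : ℝ) = n * (2 * Real.pi)) → euclidRep κ (translation v) a = a := by
      intro v hv
      refine eigenspace_ext fun k => ?_
      rw [translation_apply_amp]
      by_cases hk : k ∈ latticePoints κ
      · rw [(exp_neg_eq_one_iff _).mpr (hv k hk), one_mul]
      · rw [h k hk, mul_zero]
    induction hb using Subgroup.closure_induction with
    | mem x hx =>
      rcases hx with rfl | rfl
      · refine key _ fun k hk => ?_
        obtain ⟨n, hn⟩ := hk 0
        exact ⟨n, by rw [inner0, hn]⟩
      · refine key _ fun k hk => ?_
        obtain ⟨n, hn⟩ := hk 1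
        exact ⟨n, by rw [inner1, hn]⟩
    | one => rw [map_one]; rfl
    | mul x y _ _ hx hy => rw [map_mul, Module.End.mul_apply, hy, hx]
    | inv x _ hx =>
      conv_lhs => rw [← hx]
      rw [← Module.End.mul_apply, ← map_mul, inv_mul_cancel, map_one]
      rfl

open Classical in
/-- The restriction of the amplitudes to a symmetric set of integer wave vectors. -/
def restrict (S : Set (Circ κ)) (hneg : ∀ k, -k ∈ S ↔ k ∈ S) (hS : S ⊆ latticePoints κ) :
    eigenspace κ →L[ℝ] periodicEigenspace κ :=
  LinearMap.mkContinuous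
    { toFun := fun a =>
        ⟨⟨⟨S.indicator (a : Amp κ), memℓp_one_iff.mpr <|
            (amp_summable (a : Amp κ)).of_nonneg_of_le (fun _ => norm_nonneg _)
              (fun _ => norm_indicator_le_norm_self _ _)⟩, by
          intro k
          change S.indicator (a : Amp κ) (-k) = conj (S.indicator (a : Amp κ) k)
          by_cases hk : k ∈ S
          · rw [Set.indicator_of_mem hk, Set.indicator_of_mem ((hneg k).mpr hk)]
            exact a.2 k
          · rw [Set.indicator_of_notMem hk, Set.indicator_of_notMem (mt (hneg k).mp hk),
              map_zero]⟩,
          mem_periodicEigenspace_iff.mpr fun k hk =>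
            Set.indicator_of_notMem (fun h => hk (hS h)) _⟩
      map_add' := fun a b => periodicEigenspace_ext fun k =>
        congrFun (Set.indicator_add S (a : Amp κ) (b : Amp κ)) k
      map_smul' := fun c a => periodicEigenspace_ext fun k =>
        congrFun (Set.indicator_const_smul S c (a : Amp κ)) k }
    1 (fun a => by
      rw [one_mul]
      exact amp_norm_le_of_le fun k => norm_indicator_le_norm_self _ _)

lemma restrict_of_mem {S : Set (Circ κ)} (hneg : ∀ k, -k ∈ S ↔ k ∈ S)
    (hS : S ⊆ latticePoints κ) (a : eigenspace κ) {k : Circ κ} (hk : k ∈ S) :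
    ((restrict S hneg hS a : eigenspace κ) : Amp κ) k = (a : Amp κ) k :=
  Set.indicator_of_mem hk _

lemma restrict_of_notMem {S : Set (Circ κ)} (hneg : ∀ k, -k ∈ S ↔ k ∈ S)
    (hS : S ⊆ latticePoints κ) (a : eigenspace κ) {k : Circ κ} (hk : k ∉ S) :
    ((restrict S hneg hS a : eigenspace κ) : Amp κ) k = 0 :=
  Set.indicator_of_notMem hk _

lemma norm_restrict_le {S : Set (Circ κ)} (hneg : ∀ k, -k ∈ S ↔ k ∈ S)
    (hS : S ⊆ latticePoints κ) (a : eigenspace κ) : ‖restrict S hneg hS a‖ ≤ ‖a‖ :=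
  amp_norm_le_of_le fun _ => norm_indicator_le_norm_self _ _

/-- The restriction of the amplitudes to the integer wave vectors. -/
def toLattice : eigenspace κ →L[ℝ] periodicEigenspace κ :=
  restrict (latticePoints κ) (fun _ => neg_mem_latticePoints) subset_rfl

/-- The restriction of the amplitudes to the four wave vectors in `cross k`. -/
def toCross {k : Circ κ} (hk : k ∈ latticePoints κ) : eigenspace κ →L[ℝ] periodicEigenspace κ :=
  restrict (cross k) (fun _ => neg_mem_cross) (cross_subset_latticePoints hk)

lemma toLattice_coe (b : periodicEigenspace κ) : toLattice (b : eigenspace κ) = b := by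
  refine periodicEigenspace_ext fun k => ?_
  by_cases hk : k ∈ latticePoints κ
  · exact restrict_of_mem _ _ _ hk
  · exact (restrict_of_notMem _ _ _ hk).trans (mem_periodicEigenspace_iff.mp b.2 k hk).symm

/-! ### Consequences of irreducibility -/

lemma square_linear_invariant {g : E2} (hg : g ∈ squareEuclidean) :
    ∀ k : Circ κ, squareInvariant (rotCirc g.linearIsometryEquiv k) = squareInvariant k := by
  induction hg using Subgroup.closure_induction with
  | mem x hx =>
    intro k
    rcases hx with (rfl | rfl) | ⟨v, rfl⟩
    · have h : (rotCirc reflX.linearIsometryEquiv k : Plane) = reflX (k : Plane) := rfl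
      simp only [squareInvariant, h, reflX_apply]
      simp
    · have h : (rotCirc reflDiag.linearIsometryEquiv k : Plane) = reflDiag (k : Plane) := rfl
      simp only [squareInvariant, h, reflDiag_apply]
      simp [mul_comm]
    · rfl
  | one => intro k; rfl
  | mul x y _ _ hx hy => intro k; exact (hx _).trans (hy k)
  | inv x _ hx =>
    intro k
    refine (hx (rotCirc x⁻¹.linearIsometryEquiv k)).symm.trans ?_
    congr 1
    exact (rotCirc x.linearIsometryEquiv).apply_symm_apply k

/-- The rotation by the angle `π`. -/
def pointReflection : E2 := (LinearIsometryEquiv.neg ℝ (E := Plane)).toAffineIsometryEquiv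

lemma pointReflection_mem : pointReflection ∈ squareEuclidean := by
  have h : (reflX * reflDiag) * (reflX * reflDiag) = pointReflection := by
    ext1 r
    change reflX (reflDiag (reflX (reflDiag r))) = -r
    rw [reflDiag_apply, reflX_apply, reflDiag_apply, reflX_apply]
    ext i; fin_cases i <;> simp
  have hm : reflX * reflDiag ∈ squareEuclidean :=
    mul_mem (Subgroup.subset_closure (Or.inl (Or.inl rfl)))
      (Subgroup.subset_closure (Or.inl (Or.inr rfl)))
  exact h ▸ mul_mem hm hm

lemma pointReflection_apply_amp (a : eigenspace κ) (k : Circ κ) :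
    (euclidRep κ pointReflection a : Amp κ) k = (a : Amp κ) (-k) := by
  rw [euclidRep_apply]
  have h : pointReflection (0 : Plane) = 0 := neg_zero
  rw [h, inner_zero_right]
  simp only [Complex.ofReal_zero, mul_zero, neg_zero, Complex.exp_zero, one_mul]
  rfl

open Classical in
lemma exists_wave {k : Circ κ} (hk : k ∈ latticePoints κ) : ∃ b : periodicEigenspace κ,
    ((b : eigenspace κ) : Amp κ) k ≠ 0 ∧
      ∀ j, j ≠ k → j ≠ -k → ((b : eigenspace κ) : Amp κ) j = 0 := by
  set w : Amp κ := lp.single 1 k 1 + lp.single 1 (-k) 1 with hw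
  have hwj : ∀ j, w j = (if j = k then 1 else 0) + (if j = -k then 1 else 0) := by
    intro j
    simp [hw, lp.single_apply, Pi.single_apply]
  have hwe : w ∈ eigenspace κ := by
    intro j
    rw [hwj, hwj, map_add, add_comm]
    simp only [propext (neg_eq_iff_eq_neg (a := j) (b := k)),
      propext (neg_inj (a := j) (b := k))]
    split_ifs <;> simp
  refine ⟨⟨⟨w, hwe⟩, mem_periodicEigenspace_iff.mpr fun j hj => ?_⟩, ?_, fun j h1 h2 => ?_⟩
  · change w j = 0
    have h1 : j ≠ k := fun h => hj (h ▸ hk)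
    have h2 : j ≠ -k := fun h => hj (h ▸ neg_mem_latticePoints.mpr hk)
    rw [hwj, if_neg h1, if_neg h2, add_zero]
  · change w k ≠ 0
    rw [hwj, if_pos rfl]
    split_ifs <;> norm_num
  · change w j = 0
    rw [hwj, if_neg h1, if_neg h2, add_zero]

/-- If the representation is irreducible, then there is an integer wave vector. -/
lemma exists_mem_latticePoints (hirr : (periodicRep κ).IsIrreducible) :
    ∃ k : Circ κ, k ∈ latticePoints κ := by
  by_contra! h
  obtain ⟨x, y, hxy⟩ := hirr.toNontrivial
  refine hxy (Subrepresentation.toSubmodule_injective (Submodule.ext fun a => ?_))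
  have ha : a = 0 := periodicEigenspace_ext fun k => mem_periodicEigenspace_iff.mp a.2 k (h k)
  simp [ha]

/-- If the representation is irreducible, then all integer wave vectors are related by symmetries
of the square. -/
lemma exists_square_linear_eq (hirr : (periodicRep κ).IsIrreducible) {j k : Circ κ}
    (hj : j ∈ latticePoints κ) (hk : k ∈ latticePoints κ) :
    ∃ g ∈ squareEuclidean, rotCirc g.linearIsometryEquiv j = k := by
  set O : Set (Circ κ) := {i | ∃ g ∈ squareEuclidean, rotCirc g.linearIsometryEquiv j = i} with hO
  have hOg : ∀ g ∈ squareEuclidean, ∀ i ∈ O, rotCirc g.linearIsometryEquiv i ∈ O := by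
    rintro g hg i ⟨h, hh, rfl⟩
    exact ⟨g * h, mul_mem hg hh, rfl⟩
  have hOneg : ∀ i ∈ O, -i ∈ O := fun i hi => hOg _ pointReflection_mem i hi
  have hjO : j ∈ O := ⟨1, one_mem _, rfl⟩
  -- Fields supported on the orbit of j form a subrepresentation. A real wave at j shows that it is
  -- nonzero, hence everything, and a real wave at k then puts k in the orbit.
  let W : Subrepresentation (periodicRep κ) :=
    { toSubmodule :=
        { carrier := {a | ∀ i, i ∉ O → ((a : eigenspace κ) : Amp κ) i = 0}
          add_mem' := fun {a b} ha hb i hi => by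
            simp [ha i hi, hb i hi]
          zero_mem' := fun i _ => by simp
          smul_mem' := fun c a ha i hi => by simp [ha i hi] }
      apply_mem_toSubmodule := by
        intro g
        induction g using QuotientGroup.induction_on with
        | H g =>
          intro a ha i hi
          rw [periodicRep_mk, euclidRep_apply]
          refine mul_eq_zero_of_right _ (ha _ fun h => hi ?_)
          have := hOg g g.2 _ h
          rwa [Equiv.apply_symm_apply] at this }
  rcases hirr.eq_bot_or_eq_top W with hW | hW
  · obtain ⟨b, hb, hb'⟩ := exists_wave hj
    have hbW : b ∈ W.toSubmodule := fun i hi =>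
      hb' i (fun h => hi (h ▸ hjO)) (fun h => hi (h ▸ hOneg _ hjO))
    rw [hW] at hbW
    have hb0 : b = 0 := hbW
    rw [hb0] at hb
    exact absurd rfl hb
  · obtain ⟨b, hb, -⟩ := exists_wave hk
    have hbW : b ∈ W.toSubmodule := by rw [hW]; trivial
    by_contra hkO
    exact hb (hbW k hkO)

lemma squareInvariant_eq (hirr : (periodicRep κ).IsIrreducible) {j k : Circ κ}
    (hj : j ∈ latticePoints κ) (hk : k ∈ latticePoints κ) :
    squareInvariant j = squareInvariant k := by
  obtain ⟨g, hg, rfl⟩ := exists_square_linear_eq hirr hj hk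
  exact (square_linear_invariant hg j).symm

end HiddenSymmetry

end

noncomputable section

namespace HiddenSymmetry

/-! ### The extension of one component -/

variable {κ : ℝ}

/-- The properties of the component at the wave vector `k` of an equivariant map of the periodic
fields which are used for its extension. -/
structure IsWaveComponent (k : Circ κ) (f : periodicEigenspace κ → ℂ) : Prop where
  mem : k ∈ latticePoints κ
  invariant : ∀ j ∈ latticePoints κ, squareInvariant j = squareInvariant k
  map_translation : ∀ (v : Plane) (b c : periodicEigenspace κ),
    (∀ j, ((c : eigenspace κ) : Amp κ) j =
      Complex.exp (-(Complex.I * (inner ℝ (j : Plane) v : ℝ))) * ((b : eigenspace κ) : Amp κ) j) →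
    f c = Complex.exp (-(Complex.I * (inner ℝ (k : Plane) v : ℝ))) * f b
  map_neg : ∀ b c : periodicEigenspace κ,
    (∀ j, ((c : eigenspace κ) : Amp κ) j = ((b : eigenspace κ) : Amp κ) (-j)) → f c = conj (f b)

lemma isWaveComponent_of_equivariant (hirr : (periodicRep κ).IsIrreducible)
    {Ft : periodicEigenspace κ → periodicEigenspace κ} (hFt : Equivariant (periodicRep κ) Ft)
    {k : Circ κ} (hk : k ∈ latticePoints κ) :
    IsWaveComponent k (fun b => ((Ft b : eigenspace κ) : Amp κ) k) where
  mem := hk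
  invariant _ hj := squareInvariant_eq hirr hj hk
  map_translation v b c h := by
    let g : squareEuclidean := ⟨translation v, Subgroup.subset_closure (Or.inr ⟨v, rfl⟩)⟩
    have hc : c = periodicRep κ (g : D4T2) b := periodicEigenspace_ext fun j => by
      rw [h, periodicRep_mk]
      exact (translation_apply_amp v _ j).symm
    rw [hc, hFt, periodicRep_mk]
    exact translation_apply_amp v _ k
  map_neg b c h := by
    let g : squareEuclidean := ⟨pointReflection, pointReflection_mem⟩
    have hc : c = periodicRep κ (g : D4T2) b := periodicEigenspace_ext fun j => by
      rw [h, periodicRep_mk]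
      exact (pointReflection_apply_amp _ j).symm
    rw [hc, hFt, periodicRep_mk]
    refine (pointReflection_apply_amp _ k).trans ?_
    exact (Ft b : eigenspace κ).2 k

lemma exists_exp_mul_eq_conj (z : ℂ) :
    ∃ β : ℝ, Complex.exp (-(Complex.I * (β : ℂ))) * z = conj z := by
  -- Conjugation turns z back by twice its argument.
  refine ⟨2 * z.arg, ?_⟩
  conv_lhs => rw [← Complex.norm_mul_exp_arg_mul_I z]
  conv_rhs => rw [← Complex.norm_mul_exp_arg_mul_I z]
  rw [map_mul, Complex.conj_ofReal, ← Complex.exp_conj, map_mul, Complex.conj_ofReal,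
    Complex.conj_I, mul_left_comm, ← Complex.exp_add, Complex.norm_mul_exp_arg_mul_I]
  congr 2
  push_cast
  ring

lemma mem_cross_comm {j k : Circ κ} : j ∈ cross k ↔ k ∈ cross j := by
  have : ∀ j k : Circ κ, j ∈ cross k → k ∈ cross j := by
    rintro j k (rfl | rfl | rfl | rfl)
    · exact self_mem_cross _
    · exact neg_mem_cross.mp (self_mem_cross _)
    · exact neg_mem_cross.mp (quarterTurn_quarterTurn k ▸
        quarterTurn_mem_cross (self_mem_cross _))
    · have h := quarterTurn_mem_cross (self_mem_cross (-quarterTurn k))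
      rwa [quarterTurn_neg, quarterTurn_quarterTurn, neg_neg] at h
  exact ⟨this j k, this k j⟩

lemma rotCirc_mem_cross (hκ : 0 < κ) (L : Plane ≃ₗᵢ[ℝ] Plane) {j k : Circ κ} (h : j ∈ cross k) :
    rotCirc L j ∈ cross (rotCirc L k) := by
  have hq : rotCirc L (quarterTurn k) ∈ cross (rotCirc L k) :=
    (rotCirc_quarterTurn hκ L k).elim (fun h => Or.inr (Or.inr (Or.inl h)))
      (fun h => Or.inr (Or.inr (Or.inr h)))
  rcases h with rfl | rfl | rfl | rfl
  · exact self_mem_cross _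
  · rw [rotCirc_neg]; exact neg_mem_cross.mpr (self_mem_cross _)
  · exact hq
  · rw [rotCirc_neg]; exact neg_mem_cross.mpr hq

namespace IsWaveComponent

variable {k : Circ κ} {f : periodicEigenspace κ → ℂ}

/-- The separating translation fixes b but multiplies f(b) by a phase different from 1. -/
lemma eq_zero_of_cross (hf : IsWaveComponent k f) (hκ : 0 < κ) {b : periodicEigenspace κ}
    (hb : ∀ j ∈ cross k, ((b : eigenspace κ) : Amp κ) j = 0) : f b = 0 := by
  obtain ⟨v, hv, hv'⟩ := exists_separating_translation hκ k
  have h := hf.map_translation v b b fun j => by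
    by_cases hj : j ∈ cross k
    · rw [hb j hj, mul_zero]
    by_cases hj' : j ∈ latticePoints κ
    · rw [(exp_neg_eq_one_iff _).mpr (hv j (hf.invariant j hj') hj), one_mul]
    · rw [mem_periodicEigenspace_iff.mp b.2 j hj', mul_zero]
  by_contra hne
  exact hv' ((exp_neg_eq_one_iff _).mp ((mul_eq_right₀ hne).mp h.symm))

/-- On the cross the reflection only exchanges the amplitudes at ±`quarterTurn k`, which are
conjugate to each other. For the given a, a translation along `quarterTurn k` has the same effect,
and its phase at k is 1. -/
lemma toCross_pull_axialReflection (hf : IsWaveComponent k f) (hκ : 0 < κ) (a : eigenspace κ) :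
    f (toCross hf.mem (pull (axialReflection k) a)) = f (toCross hf.mem a) := by
  obtain ⟨β, hβ⟩ := exists_exp_mul_eq_conj ((a : Amp κ) (quarterTurn k))
  set v : Plane := (β / κ ^ 2) • (quarterTurn k : Plane) with hv
  have hv1 : (inner ℝ (k : Plane) v : ℝ) = 0 := by
    rw [hv, inner_smul_right, real_inner_comm, inner_quarterTurn, mul_zero]
  have hv2 : (inner ℝ (quarterTurn k : Plane) v : ℝ) = β := by
    rw [hv, inner_smul_right, inner_self_circ, div_mul_cancel₀ _ (by positivity)]
  have hneg : ∀ j : Circ κ, (inner ℝ ((-j : Circ κ) : Plane) v : ℝ) = -inner ℝ (j : Plane) v :=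
    fun j => inner_neg_left _ _
  have haq : (a : Amp κ) (-quarterTurn k) = conj ((a : Amp κ) (quarterTurn k)) := a.2 _
  have h := hf.map_translation v (toCross hf.mem a)
    (toCross hf.mem (pull (axialReflection k) a)) fun j => by
      by_cases hj : j ∈ cross k
      · refine (restrict_of_mem _ _ _ hj).trans (Eq.trans ?_
          (congrArg _ (restrict_of_mem _ _ _ hj).symm))
        rw [pull_apply]
        rcases hj with rfl | rfl | rfl | rfl
        · rw [axialReflection_self, hv1]; simp
        · rw [rotCirc_neg, axialReflection_self, hneg, hv1]; simp
        · rw [axialReflection_quarterTurn, hv2, hβ, haq]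
        · rw [rotCirc_neg, axialReflection_quarterTurn, neg_neg, hneg, hv2, haq, ← hβ,
            ← mul_assoc, ← Complex.exp_add]
          simp
      · exact (restrict_of_notMem _ _ _ hj).trans
          (mul_eq_zero_of_right _ (restrict_of_notMem _ _ _ hj)).symm
  rw [h, hv1]
  simp

/-- The extension of a component of an equivariant map from the periodic fields to all fields. -/
def extend (hf : IsWaveComponent k f) (a : eigenspace κ) : ℂ :=
  -- Symmetrization over the reflection, with the subtracted term removing the contribution of the
  -- cross counted twice.
  f (toLattice a) + f (toLattice (pull (axialReflection k) a)) - f (toCross hf.mem a)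

lemma extend_coe (hf : IsWaveComponent k f) (hκ : 0 < κ) (b : periodicEigenspace κ) :
    hf.extend (b : eigenspace κ) = f b := by
  have h : toLattice (pull (axialReflection k) (b : eigenspace κ)) =
      toCross hf.mem (pull (axialReflection k) (b : eigenspace κ)) := by
    refine periodicEigenspace_ext fun j => ?_
    by_cases hj : j ∈ cross k
    · exact (restrict_of_mem _ _ _ (cross_subset_latticePoints hf.mem hj)).trans
        (restrict_of_mem _ _ _ hj).symm
    refine Eq.trans ?_ (restrict_of_notMem _ _ _ hj).symm
    by_cases hjl : j ∈ latticePoints κ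
    · refine (restrict_of_mem _ _ _ hjl).trans ?_
      rw [pull_apply]
      refine mem_periodicEigenspace_iff.mp b.2 _ fun hσ => hj ?_
      -- A lattice vector off the cross has its mirror image off the lattice, where b has no
      -- amplitude.
      exact mem_cross_of_axialReflection hκ hf.mem (hf.invariant _ hjl) (hf.invariant _ hσ)
    · exact restrict_of_notMem _ _ _ hjl
  rw [extend, toLattice_coe, h, hf.toCross_pull_axialReflection hκ, add_sub_cancel_right]

lemma extend_eq_zero (hf : IsWaveComponent k f) (hκ : 0 < κ) {a : eigenspace κ}
    (ha : ∀ j ∈ cross k, (a : Amp κ) j = 0) : hf.extend a = 0 := by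
  have hl : ∀ j ∈ cross k, j ∈ latticePoints κ := cross_subset_latticePoints hf.mem
  rw [extend, hf.eq_zero_of_cross hκ (b := toLattice a), hf.eq_zero_of_cross hκ
    (b := toLattice (pull (axialReflection k) a)), hf.eq_zero_of_cross hκ (b := toCross hf.mem a)]
  · simp
  · exact fun j hj => (restrict_of_mem _ _ _ hj).trans (ha j hj)
  · refine fun j hj => (restrict_of_mem _ _ _ (hl j hj)).trans ?_
    rw [pull_apply]
    have h := rotCirc_mem_cross hκ (axialReflection k) hj
    rw [axialReflection_self] at h
    exact ha _ h
  · exact fun j hj => (restrict_of_mem _ _ _ (hl j hj)).trans (ha j hj)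

lemma restrict_congr {S : Set (Circ κ)} (hneg : ∀ k, -k ∈ S ↔ k ∈ S)
    (hS : S ⊆ latticePoints κ) {a c : eigenspace κ} {θ : Circ κ → ℂ}
    (h : ∀ j, (c : Amp κ) j = θ j * (a : Amp κ) j) (j : Circ κ) :
    ((restrict S hneg hS c : eigenspace κ) : Amp κ) j =
      θ j * ((restrict S hneg hS a : eigenspace κ) : Amp κ) j := by
  by_cases hj : j ∈ S
  · rw [restrict_of_mem _ _ _ hj, restrict_of_mem _ _ _ hj, h]
  · rw [restrict_of_notMem _ _ _ hj, restrict_of_notMem _ _ _ hj, mul_zero]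

lemma restrict_neg {S : Set (Circ κ)} (hneg : ∀ k, -k ∈ S ↔ k ∈ S)
    (hS : S ⊆ latticePoints κ) {a c : eigenspace κ}
    (h : ∀ j, (c : Amp κ) j = (a : Amp κ) (-j)) (j : Circ κ) :
    ((restrict S hneg hS c : eigenspace κ) : Amp κ) j =
      ((restrict S hneg hS a : eigenspace κ) : Amp κ) (-j) := by
  by_cases hj : j ∈ S
  · rw [restrict_of_mem _ _ _ hj, restrict_of_mem _ _ _ ((hneg j).mpr hj), h]
  · rw [restrict_of_notMem _ _ _ hj, restrict_of_notMem _ _ _ (mt (hneg j).mp hj)]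

/-- In the reflected term the translation vector is reflected too, but k is fixed by the reflection,
so all three terms acquire the same phase. -/
lemma extend_translation (hf : IsWaveComponent k f) (v : Plane) (a : eigenspace κ) :
    hf.extend (euclidRep κ (translation v) a) =
      Complex.exp (-(Complex.I * (inner ℝ (k : Plane) v : ℝ))) * hf.extend a := by
  have hσ : ∀ j : Circ κ, (pull (axialReflection k) (euclidRep κ (translation v) a) : Amp κ) j =
      Complex.exp (-(Complex.I * (inner ℝ (j : Plane) ((axialReflection k).symm v) : ℝ))) *
        (pull (axialReflection k) a : Amp κ) j := by
    intro j
    rw [pull_apply, translation_apply_amp, pull_apply, rotCirc_coe,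
      ← (axialReflection k).inner_map_map j, LinearIsometryEquiv.apply_symm_apply]
  have hk : (inner ℝ (k : Plane) ((axialReflection k).symm v) : ℝ) = inner ℝ (k : Plane) v := by
    rw [← (axialReflection k).inner_map_map, LinearIsometryEquiv.apply_symm_apply]
    have e : axialReflection k k = k := congrArg Subtype.val (axialReflection_self k)
    rw [e]
  have h1 := hf.map_translation v (toLattice a) (toLattice _)
    (restrict_congr _ _ (translation_apply_amp v a))
  have h2 := hf.map_translation _ (toLattice (pull (axialReflection k) a)) (toLattice _)
    (restrict_congr _ _ hσ)
  have h3 := hf.map_translation v (toCross hf.mem a) (toCross hf.mem _)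
    (restrict_congr _ _ (translation_apply_amp v a))
  rw [extend, extend, h1, h2, h3, hk]
  ring

lemma extend_neg (hf : IsWaveComponent k f) {a c : eigenspace κ}
    (h : ∀ j, (c : Amp κ) j = (a : Amp κ) (-j)) : hf.extend c = conj (hf.extend a) := by
  have hσ : ∀ j, (pull (axialReflection k) c : Amp κ) j =
      (pull (axialReflection k) a : Amp κ) (-j) := fun j => by
    rw [pull_apply, pull_apply, h, rotCirc_neg]
  have h1 := hf.map_neg (toLattice a) (toLattice c) (restrict_neg _ _ h)
  have h2 := hf.map_neg (toLattice (pull (axialReflection k) a)) (toLattice _)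
    (restrict_neg _ _ hσ)
  have h3 := hf.map_neg (toCross hf.mem a) (toCross hf.mem c) (restrict_neg _ _ h)
  rw [extend, extend, h1, h2, h3, map_sub, map_add]

lemma extend_pull_axialReflection (hf : IsWaveComponent k f) (hκ : 0 < κ) (a : eigenspace κ) :
    hf.extend (pull (axialReflection k) a) = hf.extend a := by
  have h : pull (axialReflection k) (pull (axialReflection k) a) = a :=
    eigenspace_ext fun j => by
      rw [pull_apply, pull_apply, axialReflection_axialReflection]
  rw [extend, extend, h, hf.toCross_pull_axialReflection hκ, add_comm (f (toLattice a))]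

/-- This makes the amplitude at j independent of the isometry carrying k to j: two choices differ at
most by the axial reflection. -/
lemma extend_pull_congr (hf : IsWaveComponent k f) (hκ : 0 < κ) {L M : Plane ≃ₗᵢ[ℝ] Plane}
    (h : rotCirc L k = rotCirc M k) (a : eigenspace κ) :
    hf.extend (pull L a) = hf.extend (pull M a) := by
  rcases eq_or_eq_trans_axialReflection hκ h with rfl | rfl
  · rfl
  · rw [← hf.extend_pull_axialReflection hκ (pull M a)]
    congr 1
    refine eigenspace_ext fun j => ?_
    rw [pull_apply, pull_apply, pull_apply]
    rfl

/-! ### The extension of the map -/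

/-- The amplitudes of the extended map, which need not be summable. -/
def extension (hf : IsWaveComponent k f) (a : eigenspace κ) (j : Circ κ) : ℂ :=
  hf.extend (pull (swapReflection k j) a)

lemma extension_eq (hf : IsWaveComponent k f) (hκ : 0 < κ) {L : Plane ≃ₗᵢ[ℝ] Plane} {j : Circ κ}
    (h : rotCirc L k = j) (a : eigenspace κ) : hf.extension a j = hf.extend (pull L a) :=
  hf.extend_pull_congr hκ (by rw [swapReflection_apply, h]) a

lemma extension_self (hf : IsWaveComponent k f) (hκ : 0 < κ) (a : eigenspace κ) :
    hf.extension a k = hf.extend a := by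
  refine (hf.extension_eq hκ (L := LinearIsometryEquiv.refl ℝ Plane) rfl a).trans ?_
  congr 1
  exact eigenspace_ext fun j => by rw [pull_apply]; rfl

lemma extension_euclidRep (hf : IsWaveComponent k f) (hκ : 0 < κ) (g : E2) (a : eigenspace κ) :
    hf.extension (euclidRep κ g a) = transformed g (hf.extension a) := by
  funext j
  set R := swapReflection k j
  have hR : rotCirc R k = j := swapReflection_apply k j
  have hRk : R (k : Plane) = j := congrArg Subtype.val hR
  -- The linear part of g is absorbed into the choice of isometry, leaving a translation whose phase
  -- at k is known.
  have h : pull R (euclidRep κ g a) = euclidRep κ (translation (R.symm (g 0)))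
      (pull (R.trans g.linearIsometryEquiv.symm) a) := by
    refine eigenspace_ext fun i => ?_
    rw [pull_apply, translation_apply_amp, pull_apply, euclidRep_apply, rotCirc_coe,
      ← R.inner_map_map i, LinearIsometryEquiv.apply_symm_apply]
    rfl
  rw [transformed, hf.extension_eq hκ (L := R.trans g.linearIsometryEquiv.symm)
    (congrArg (rotCirc g.linearIsometryEquiv).symm hR), extension]
  change hf.extend (pull R _) = _
  rw [h, hf.extend_translation, ← R.inner_map_map, LinearIsometryEquiv.apply_symm_apply, hRk]

lemma extension_neg (hf : IsWaveComponent k f) (hκ : 0 < κ) (a : eigenspace κ) (j : Circ κ) :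
    hf.extension a (-j) = conj (hf.extension a j) := by
  set R := swapReflection k j
  have hR : rotCirc R k = j := swapReflection_apply k j
  have h : rotCirc (R.trans (LinearIsometryEquiv.neg ℝ)) k = -j := by
    rw [← hR]; rfl
  rw [hf.extension_eq hκ h, hf.extension_eq hκ hR]
  refine hf.extend_neg fun i => ?_
  rw [pull_apply, pull_apply, rotCirc_neg]
  rfl

/-- If j is not a lattice point, neither is any vector of its cross, so b has no amplitude there. -/
lemma extension_eq_zero (hf : IsWaveComponent k f) (hκ : 0 < κ) (b : periodicEigenspace κ)
    {j : Circ κ} (hj : j ∉ latticePoints κ) : hf.extension (b : eigenspace κ) j = 0 := by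
  refine hf.extend_eq_zero hκ fun i hi => ?_
  rw [pull_apply]
  refine mem_periodicEigenspace_iff.mp b.2 _ fun hl => hj ?_
  have h := rotCirc_mem_cross hκ (swapReflection k j) hi
  rw [swapReflection_apply] at h
  exact cross_subset_latticePoints hl (mem_cross_comm.mp h)

end IsWaveComponent

lemma extension_coe (hκ : 0 < κ) (hirr : (periodicRep κ).IsIrreducible)
    {Ft : periodicEigenspace κ → periodicEigenspace κ} (hFt : Equivariant (periodicRep κ) Ft)
    {k : Circ κ} (hk : k ∈ latticePoints κ) (b : periodicEigenspace κ) :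
    (isWaveComponent_of_equivariant hirr hFt hk).extension (b : eigenspace κ) =
      ((Ft b : eigenspace κ) : Amp κ) := by
  set hf := isWaveComponent_of_equivariant hirr hFt hk
  funext j
  by_cases hj : j ∈ latticePoints κ
  · obtain ⟨g, hg, hgj⟩ := exists_square_linear_eq hirr hk hj
    let g' : squareEuclidean := ⟨g⁻¹, inv_mem hg⟩
    -- A symmetry g of the square carrying k to j acts equivariantly on both sides, reducing the
    -- amplitude at j to that at k.
    have h1 := congrFun (hf.extension_euclidRep hκ g⁻¹ (b : eigenspace κ)) k
    have h2 : hf.extension (euclidRep κ g⁻¹ (b : eigenspace κ)) k =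
        transformed g⁻¹ ((Ft b : eigenspace κ) : Amp κ) k := by
      rw [hf.extension_self hκ]
      have h := hf.extend_coe hκ (periodicRep κ (g' : D4T2) b)
      rw [hFt] at h
      exact h
    have h3 : (rotCirc (κ := κ) (g⁻¹).linearIsometryEquiv).symm k = j := hgj
    rw [h2, transformed, transformed, h3] at h1
    exact (mul_left_cancel₀ (Complex.exp_ne_zero _) h1).symm
  · rw [hf.extension_eq_zero hκ b hj]
    exact (mem_periodicEigenspace_iff.mp (Ft b).2 j hj).symm

end HiddenSymmetry

end

noncomputable section

namespace HiddenSymmetry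

/-! ### Smoothness of the extension -/

variable {κ : ℝ}

/-- Rotation of the wave vectors by a right angle, as an equivalence. -/
def quarterTurnEquiv (κ : ℝ) : Circ κ ≃ Circ κ where
  toFun := quarterTurn
  invFun k := -quarterTurn k
  left_inv k := by simp [quarterTurn_quarterTurn]
  right_inv k := by simp [quarterTurn_neg, quarterTurn_quarterTurn]

/-- The sum of the moduli of the amplitudes at the four wave vectors of `cross k`. -/
def crossNorm (a : Amp κ) (k : Circ κ) : ℝ :=
  ‖a k‖ + ‖a (-k)‖ + (‖a (quarterTurn k)‖ + ‖a (-quarterTurn k)‖)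

lemma hasSum_crossNorm (a : Amp κ) : HasSum (crossNorm a) (4 * ‖a‖) := by
  have h : HasSum (fun k => ‖a k‖) ‖a‖ := amp_norm_eq a ▸ (amp_summable a).hasSum
  have h' : HasSum (fun k => ‖a (-k)‖) ‖a‖ := (Equiv.neg (Circ κ)).hasSum_iff.mpr h
  have := (h.add h').add (((quarterTurnEquiv κ).hasSum_iff.mpr h).add
    ((quarterTurnEquiv κ).hasSum_iff.mpr h'))
  convert! this using 1
  ring

open Classical in
lemma norm_toCross_le {k : Circ κ} (hk : k ∈ latticePoints κ) (a : eigenspace κ) :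
    ‖toCross hk a‖ ≤ crossNorm (a : Amp κ) k := by
  have h := ((hasSum_ite_eq k ‖(a : Amp κ) k‖).add (hasSum_ite_eq (-k) ‖(a : Amp κ) (-k)‖)).add
    ((hasSum_ite_eq (quarterTurn k) ‖(a : Amp κ) (quarterTurn k)‖).add
      (hasSum_ite_eq (-quarterTurn k) ‖(a : Amp κ) (-quarterTurn k)‖))
  have hd := (amp_summable ((toCross hk a : eigenspace κ) : Amp κ)).hasSum
  rw [← amp_norm_eq] at hd
  refine hasSum_le (fun j => ?_) hd h
  have hnn : ∀ i : Circ κ, 0 ≤ if j = i then ‖(a : Amp κ) i‖ else 0 := fun i => by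
    split_ifs <;> positivity
  have h1 := hnn k
  have h2 := hnn (-k)
  have h3 := hnn (quarterTurn k)
  have h4 := hnn (-quarterTurn k)
  by_cases hj : j ∈ cross k
  · have he : ((toCross hk a : eigenspace κ) : Amp κ) j = (a : Amp κ) j := restrict_of_mem _ _ _ hj
    have hs : ∀ i, j = i → ‖(a : Amp κ) j‖ = if j = i then ‖(a : Amp κ) i‖ else 0 :=
      fun i hi => by rw [if_pos hi, hi]
    rw [he]
    rcases hj with h | h | h | h <;> have := hs _ h <;> linarith
  · have he : ((toCross hk a : eigenspace κ) : Amp κ) j = 0 := restrict_of_notMem _ _ _ hj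
    rw [he, norm_zero]
    linarith

/-- Isometries map crosses to crosses. An orientation-reversing one only exchanges the two quarter
turns, which leaves the sum unchanged. -/
lemma crossNorm_pull (hκ : 0 < κ) (L : Plane ≃ₗᵢ[ℝ] Plane) (a : eigenspace κ) (k : Circ κ) :
    crossNorm (pull L a : Amp κ) k = crossNorm (a : Amp κ) (rotCirc L k) := by
  simp only [crossNorm, pull_apply, rotCirc_neg]
  rcases rotCirc_quarterTurn hκ L k with h | h <;> rw [h]
  rw [neg_neg, add_comm ‖(a : Amp κ) (-quarterTurn _)‖]

/-- The projection to the amplitudes of the real-valued fields. -/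
def realPart : Amp κ →L[ℝ] eigenspace κ :=
  have hs (a : Amp κ) : Summable fun k => (2 : ℝ)⁻¹ * (‖a k‖ + ‖a (-k)‖) :=
    ((amp_summable a).add ((Equiv.neg (Circ κ)).summable_iff.mpr (amp_summable a))).mul_left _
  have hle (a : Amp κ) (k : Circ κ) :
      ‖(2 : ℂ)⁻¹ * (a k + conj (a (-k)))‖ ≤ (2 : ℝ)⁻¹ * (‖a k‖ + ‖a (-k)‖) := by
    rw [norm_mul, norm_inv, Complex.norm_two]
    gcongr
    exact (norm_add_le _ _).trans_eq (by rw [RCLike.norm_conj])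
  LinearMap.mkContinuous
    { toFun := fun a => ⟨⟨fun k => (2 : ℂ)⁻¹ * (a k + conj (a (-k))), memℓp_one_iff.mpr <|
          (hs a).of_nonneg_of_le (fun _ => norm_nonneg _) (hle a)⟩, fun k => by
            change (2 : ℂ)⁻¹ * (a (-k) + conj (a (- -k))) = conj ((2 : ℂ)⁻¹ * (a k + conj (a (-k))))
            rw [neg_neg, map_mul, map_add, Complex.conj_conj, map_inv₀, map_ofNat, add_comm]⟩
      map_add' := fun a b => eigenspace_ext fun k => by
        change (2 : ℂ)⁻¹ * ((a k + b k) + conj (a (-k) + b (-k))) =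
          (2 : ℂ)⁻¹ * (a k + conj (a (-k))) + (2 : ℂ)⁻¹ * (b k + conj (b (-k)))
        rw [map_add]; ring
      map_smul' := fun c a => eigenspace_ext fun k => by
        change (2 : ℂ)⁻¹ * (c • a k + conj (c • a (-k))) = c • ((2 : ℂ)⁻¹ * (a k + conj (a (-k))))
        simp only [Complex.real_smul, map_mul, Complex.conj_ofReal]; ring }
    1 (fun a => by
      have h := (hs a).of_nonneg_of_le (fun _ => norm_nonneg _) (hle a) |>.tsum_le_tsum (hle a) (hs a)
      have hn : Summable fun k => ‖a (-k)‖ :=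
        (Equiv.neg (Circ κ)).summable_iff.mpr (amp_summable a)
      have ht : ∑' k, ‖a (-k)‖ = ‖a‖ :=
        ((Equiv.neg (Circ κ)).tsum_eq fun k => ‖a k‖).trans (amp_norm_eq a).symm
      refine (amp_norm_eq _).trans_le (h.trans_eq ?_)
      rw [tsum_mul_left, (amp_summable a).tsum_add hn, ht, ← amp_norm_eq]
      ring)

lemma realPart_coe (a : eigenspace κ) : realPart (a : Amp κ) = a := by
  refine eigenspace_ext fun k => ?_
  change (2 : ℂ)⁻¹ * ((a : Amp κ) k + conj ((a : Amp κ) (-k))) = _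
  rw [a.2 k, Complex.conj_conj]
  ring

namespace IsWaveComponent

variable {k : Circ κ} {f : periodicEigenspace κ → ℂ}

lemma finite_latticePoints (hf : IsWaveComponent k f) : (latticePoints κ).Finite := by
  have h : ∀ k : Circ κ, (cross k).Finite := fun k =>
    (Set.toFinite {k, -k, quarterTurn k, -quarterTurn k}).subset fun _ h => h
  exact ((h k).union (h (mirror k))).subset fun j hj =>
    mem_cross_or_mem_cross_mirror (hf.invariant j hj)

lemma properSpace (hf : IsWaveComponent k f) : ProperSpace (periodicEigenspace κ) := by
  have := hf.finite_latticePoints.to_subtype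
  let φ : periodicEigenspace κ →ₗ[ℝ] (latticePoints κ → ℂ) :=
    { toFun := fun b j => ((b : eigenspace κ) : Amp κ) j
      map_add' := fun _ _ => rfl
      map_smul' := fun _ _ => rfl }
  have hφ : Function.Injective φ := fun a b h => periodicEigenspace_ext fun j => by
    by_cases hj : j ∈ latticePoints κ
    · exact congrFun h ⟨j, hj⟩
    · rw [mem_periodicEigenspace_iff.mp a.2 j hj, mem_periodicEigenspace_iff.mp b.2 j hj]
  have := FiniteDimensional.of_injective φ hφ
  exact FiniteDimensional.proper_real (periodicEigenspace κ)

-- Each of the three terms of the extension has this form. Since Q preserves the cross of k, the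
-- π-part of the j-th entry is bounded by the cross sum of a at j, which is summable over j.
set_option maxSynthPendingDepth 6 in
lemma exists_contDiff_rotated (hf : IsWaveComponent k f) (hκ : 0 < κ) (hs : ContDiff ℝ ∞ f)
    (Q : eigenspace κ →L[ℝ] periodicEigenspace κ)
    (hQ1 : ∀ a, ‖Q a‖ ≤ ‖a‖) (hQ : ∀ a, ∀ j ∈ cross k, ((Q a : eigenspace κ) : Amp κ) j = (a : Amp κ) j)
    {M : Circ κ → Plane ≃ₗᵢ[ℝ] Plane} (hM : ∀ j, rotCirc (M j) k = j) :
    ∃ T : eigenspace κ → Amp κ, ContDiff ℝ ∞ T ∧ ∀ a j, T a j = f (Q (pull (M j) a)) := by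
  have := hf.properSpace
  let π : periodicEigenspace κ →L[ℝ] periodicEigenspace κ :=
    (toCross hf.mem).comp (periodicEigenspace κ).subtypeL
  have hπ : ∀ b, ∀ j ∈ cross k,
      ((π b : eigenspace κ) : Amp κ) j = ((b : eigenspace κ) : Amp κ) j :=
    fun b j hj => restrict_of_mem (fun _ => neg_mem_cross) (cross_subset_latticePoints hf.mem) _ hj
  have hπQ : ∀ a, π (Q a) = toCross hf.mem a := fun a => periodicEigenspace_ext fun j => by
    by_cases hj : j ∈ cross k
    · exact (hπ _ j hj).trans ((hQ a j hj).trans (restrict_of_mem _ _ _ hj).symm)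
    · exact (restrict_of_notMem (fun _ => neg_mem_cross) (cross_subset_latticePoints hf.mem)
        _ hj).trans (restrict_of_notMem _ _ _ hj).symm
  have hle : ∀ (a : eigenspace κ) (j : Circ κ),
      ‖π (Q (pull (M j) a))‖ ≤ crossNorm (a : Amp κ) j := fun a j => by
    rw [hπQ]
    refine (norm_toCross_le hf.mem _).trans_eq ?_
    rw [crossNorm_pull hκ, hM]
  have hsum : ∀ a : eigenspace κ, Summable fun j => ‖π (Q (pull (M j) a))‖ := fun a =>
    (hasSum_crossNorm (a : Amp κ)).summable.of_nonneg_of_le (fun _ => norm_nonneg _) (hle a)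
  -- The circle serves only as an index set: no continuity in j is available, so the discrete
  -- topology is imposed.
  let _ : TopologicalSpace (Circ κ) := ⊥
  have : DiscreteTopology (Circ κ) := ⟨rfl⟩
  exact exists_contDiff_apply_family (E := eigenspace κ) (V := periodicEigenspace κ)
    (fun j => Q.comp (pull (M j))) zero_le_one
    (fun j a => (hQ1 _).trans ((norm_pull_le _ _).trans_eq (one_mul _).symm)) π hsum
    (D := 4) (fun a => hasSum_le (hle a) (hsum a).hasSum (hasSum_crossNorm (a : Amp κ))) hs
    fun v => hf.eq_zero_of_cross hκ fun j hj => sub_eq_zero.mpr (hπ v j hj).symm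

/-- The extension of a smooth map has summable amplitudes and is smooth. -/
lemma exists_contDiff_extension (hf : IsWaveComponent k f) (hκ : 0 < κ) (hs : ContDiff ℝ ∞ f) :
    ∃ T : eigenspace κ → Amp κ, ContDiff ℝ ∞ T ∧ ∀ a, (T a : Circ κ → ℂ) = hf.extension a := by
  have hl : ∀ a : eigenspace κ, ∀ j ∈ cross k,
      ((toLattice a : eigenspace κ) : Amp κ) j = (a : Amp κ) j := fun a j hj =>
    restrict_of_mem _ _ _ (cross_subset_latticePoints hf.mem hj)
  -- The reflected term is the same construction with another isometry carrying k to j.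
  have hσ : ∀ j, rotCirc ((axialReflection k).trans (swapReflection k j)) k = j := fun j =>
    (congrArg (rotCirc (swapReflection k j)) (axialReflection_self k)).trans
      (swapReflection_apply k j)
  obtain ⟨T₁, hT₁, h₁⟩ := hf.exists_contDiff_rotated hκ hs toLattice (norm_restrict_le _ _) hl (swapReflection_apply k)
  obtain ⟨T₂, hT₂, h₂⟩ := hf.exists_contDiff_rotated hκ hs toLattice (norm_restrict_le _ _) hl hσ
  obtain ⟨T₃, hT₃, h₃⟩ := hf.exists_contDiff_rotated hκ hs (toCross hf.mem)
    (norm_restrict_le _ _) (fun a j hj => restrict_of_mem _ _ _ hj) (swapReflection_apply k)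
  refine ⟨fun a => T₁ a + T₂ a - T₃ a, (hT₁.add hT₂).sub hT₃, fun a => funext fun j => ?_⟩
  change T₁ a j + T₂ a j - T₃ a j = _
  have h : pull ((axialReflection k).trans (swapReflection k j)) a =
      pull (axialReflection k) (pull (swapReflection k j) a) :=
    eigenspace_ext fun i => by rw [pull_apply, pull_apply, pull_apply]; rfl
  rw [h₁, h₂, h₃, h]
  rfl

/-! ### The equivariant extension and its regularity. -/

open Classical in
/-- The extended map, set to zero where the extended amplitudes fail to be summable. -/
def extendedMap (hf : IsWaveComponent k f) (hκ : 0 < κ) (a : eigenspace κ) : eigenspace κ :=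
  if h : Memℓp (hf.extension a) 1 then ⟨⟨hf.extension a, h⟩, hf.extension_neg hκ a⟩ else 0

lemma extendedMap_eq (hf : IsWaveComponent k f) (hκ : 0 < κ) {a c : eigenspace κ}
    (h : hf.extension a = (c : Amp κ)) : hf.extendedMap hκ a = c := by
  have hm : Memℓp (hf.extension a) 1 := h ▸ lp.memℓp (c : Amp κ)
  rw [extendedMap, dif_pos hm]
  exact eigenspace_ext fun j => congrFun h j

lemma equivariant_extendedMap (hf : IsWaveComponent k f) (hκ : 0 < κ) :
    Equivariant (euclidRep κ) (hf.extendedMap hκ) := by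
  have key : ∀ (g : E2) (a : eigenspace κ), Memℓp (hf.extension a) 1 →
      hf.extendedMap hκ (euclidRep κ g a) = euclidRep κ g (hf.extendedMap hκ a) := by
    intro g a h
    apply hf.extendedMap_eq hκ
    rw [hf.extension_euclidRep hκ, extendedMap, dif_pos h]
    rfl
  intro g a
  by_cases h : Memℓp (hf.extension a) 1
  · exact key g a h
  -- Summability is invariant under the group, so the value 0 is used consistently along orbits;
  -- this mixed case is settled by applying the summable one to g⁻¹.
  by_cases h' : Memℓp (hf.extension (euclidRep κ g a)) 1
  · have h2 := congrArg (euclidRep κ g) (key g⁻¹ _ h')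
    rwa [← Module.End.mul_apply, ← Module.End.mul_apply, ← map_mul, ← map_mul, mul_inv_cancel,
      inv_mul_cancel, map_one, Module.End.one_apply, Module.End.one_apply, eq_comm] at h2
  · rw [extendedMap, dif_neg h', extendedMap, dif_neg h, map_zero]

lemma contDiff_extendedMap (hf : IsWaveComponent k f) (hκ : 0 < κ) (hs : ContDiff ℝ ∞ f) :
    ContDiff ℝ ∞ (hf.extendedMap hκ) := by
  obtain ⟨T, hT, h⟩ := hf.exists_contDiff_extension hκ hs
  -- The bounded projection onto real fields transfers smoothness from ℓ¹ to the subspace.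
  have hF : hf.extendedMap hκ = fun a => realPart (T a) := by
    funext a
    have hm : T a ∈ eigenspace κ := fun j => by rw [h]; exact hf.extension_neg hκ a j
    rw [hf.extendedMap_eq hκ (c := ⟨T a, hm⟩) (h a).symm]
    exact (realPart_coe ⟨T a, hm⟩).symm
  rw [hF]
  exact realPart.contDiff.comp hT

lemma extendedMap_smul (hf : IsWaveComponent k f) (hκ : 0 < κ) (hs : ContDiff ℝ ∞ f) {p : ℕ}
    (hp : ∀ (t : ℝ) b, f (t • b) = t ^ p • f b) (t : ℝ) (a : eigenspace κ) :
    hf.extendedMap hκ (t • a) = t ^ p • hf.extendedMap hκ a := by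
  obtain ⟨T, -, h⟩ := hf.exists_contDiff_extension hκ hs
  have hm : Memℓp (hf.extension a) 1 := h a ▸ lp.memℓp (T a)
  apply hf.extendedMap_eq hκ
  rw [extendedMap, dif_pos hm]
  funext j
  change hf.extension (t • a) j = t ^ p • hf.extension a j
  simp only [extension, extend, map_smul, hp, smul_sub, smul_add]

end IsWaveComponent

/-! ### Homogeneous polynomial maps and amplitude functionals. -/

lemma IsHomogeneousPolynomial.contDiff {V : Type*} [NormedAddCommGroup V] [NormedSpace ℝ V]
    {p : ℕ} {F : V → V} (hF : IsHomogeneousPolynomial p F) : ContDiff ℝ ∞ F := by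
  obtain ⟨M, hM⟩ := hF
  rw [funext hM]
  exact M.contDiff.comp (contDiff_pi.mpr fun _ => contDiff_id)

lemma IsHomogeneousPolynomial.map_smul {V : Type*} [NormedAddCommGroup V] [NormedSpace ℝ V]
    {p : ℕ} {F : V → V} (hF : IsHomogeneousPolynomial p F) (t : ℝ) (v : V) :
    F (t • v) = t ^ p • F v := by
  obtain ⟨M, hM⟩ := hF
  rw [hM, hM]
  simpa using M.map_smul_univ (fun _ => t) (fun _ => v)

/-- The amplitude at one wave vector, as a continuous linear function. -/
def amplitude (k : Circ κ) : periodicEigenspace κ →L[ℝ] ℂ :=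
  LinearMap.mkContinuous
    { toFun := fun b => ((b : eigenspace κ) : Amp κ) k
      map_add' := fun _ _ => rfl
      map_smul' := fun _ _ => rfl }
    1 (fun b => by
      rw [one_mul]
      exact lp.norm_apply_le_norm one_ne_zero ((b : eigenspace κ) : Amp κ) k)

set_option maxSynthPendingDepth 6 in
lemma contDiff_amplitude {F : periodicEigenspace κ → periodicEigenspace κ} (hF : ContDiff ℝ ∞ F)
    (k : Circ κ) : ContDiff ℝ ∞ fun b => ((F b : eigenspace κ) : Amp κ) k :=
  have h : ContDiff ℝ ∞ (amplitude k) :=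
    ContinuousLinearMap.contDiff (E := periodicEigenspace κ) (amplitude k)
  ContDiff.comp h hF

end HiddenSymmetry

end

/-! ### Proof of the extension theorem. -/

open HiddenSymmetry in
theorem mainTheorem1 (κ : ℝ) (hκ : 0 < κ)
    (hirr : (periodicRep κ).IsIrreducible)
    (Ft : periodicEigenspace κ → periodicEigenspace κ)
    (hFt : Equivariant (periodicRep κ) Ft) :
    ∃ F : eigenspace κ → eigenspace κ,
      Equivariant (euclidRep κ) F ∧
      (∀ a : periodicEigenspace κ, F a = Ft a) ∧
      (ContDiff ℝ ∞ Ft → ContDiff ℝ ∞ F) ∧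
      (∀ p : ℕ, IsHomogeneousPolynomial p Ft → IsHomogeneousPolynomial p F) := by
  obtain ⟨k, hk⟩ := exists_mem_latticePoints hirr
  have hf := isWaveComponent_of_equivariant hirr hFt hk
  have hs : ContDiff ℝ ∞ Ft → ContDiff ℝ ∞ fun b => ((Ft b : eigenspace κ) : Amp κ) k :=
    fun h => contDiff_amplitude h k
  refine ⟨hf.extendedMap hκ, hf.equivariant_extendedMap hκ,
    fun b => hf.extendedMap_eq hκ (extension_coe hκ hirr hFt hk b),
    fun h => hf.contDiff_extendedMap hκ (hs h), fun p hp => ?_⟩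
  refine isHomogeneousPolynomial_of_contDiff (hf.contDiff_extendedMap hκ (hs hp.contDiff)) p
    (hf.extendedMap_smul hκ (hs hp.contDiff) fun t b => ?_)
  rw [hp.map_smul]
  rfl
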